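/- Let $n_1,n_2,r\ge 1$ and let $Y=L^*+S^*\in\mathbb{R}^{n_1\times n_2}$, where: - each row of $S^*$ has at most $\gamma^* n_2$ and each column at most $\gamma^* n_1$ nonzero entries, for some $\gamma^*\in[0,1)$; - $L^*$ has rank $r$ and is $\mu$-incoherent: in a compact singular value decomposition $L^*=U^*\Sigma^*V^{*T}$ with $U^*\in\mathbb{R}^{n_1\times r}$, $V^*\in\mathbb{R}^{n_2\times r}$, one has $\|U^*\|_{2,\infty}\le\sqrt{\mu r/n_1}$ and $\|V^*\|_{2,\infty}\le\sqrt{\mu r/n_2}$, where $\|A\|_{2,\infty}=\max_{\|z\|_2=1}\|Az\|_\infty$. Let $\mathcal M$ be the manifold of real $n_1\times n_2$ matrices of rank $r$, with tangent space $T_X\mathcal M=\{AX+XB: A\in\mathbb{R}^{n_1\times n_1},B\in\mathbb{R}^{n_2\times n_2}\}$ at $X\in\mathcal M$, and let $P_{T_X}$ be the orthogonal projection to $T_X\mathcal M$ for the Frobenius inner product. For $\gamma>0$ let $F(A)$ be the matrix obtained from $A$ by replacing with $0$ every entry that is among the largest $\gamma$-fraction, in absolute value, both of its row and of its column. Here the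 largest $\gamma$-fraction of $v\in\mathbb{R}^n$ is a set of at most $\gamma n$ entries that, for some $t$ with $\#\{j:|v_j|>t\}\le\gamma n\le\#\{j:|v_j|\ge t\}$, contains all entries with $|v_j|>t$ and none with $|v_j|<t$; ties are broken arbitrarily. For a starting point $L^{(0)}\in\mathcal M$ and a step size $\eta>0$, Riemannian gradient descent is the iteration $$L^{(k+1)}=R_{L^{(k)}}\big(-\eta\,P_{T_{L^{(k)}}}F(L^{(k)}-Y)\big),$$ where $R$ is one of the following two retractions: the projective retraction, for which $R_X(\delta)$ is a minimizer of $\|X+\delta-Z\|_F$ over $Z\in\mathcal M$, or the orthographic retraction, for which $R_X(\delta)$ is a minimizer of $\|X+\delta-Z\|_F$ over those $Z\in\mathcal M$ for which $Z-X-\delta$ is orthogonal to $T_X\mathcal M$. Suppose that $\|L^{(0)}-L^*\|_F\le a\,\sigma_r(L^*)$, where $\sigma_r(L^*)$ is the $r$-th largest singular value of $L^*$, that $a\le\tfrac12$ and $\gamma>2\gamma^*$, and that $$C_1=\sqrt{4(\gamma+2\gamma^*)\mu r+4\,\frac{\gamma^*}{\gamma-\gamma^*}+a^2}<\tfrac12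 .$$ Then there is $\eta_0>0$ such that for all step sizes $0<\eta<\eta_0$ and for each of the two retractions, however ties and the choice of minimizers are resolved, the iteration is well defined (the minimum that defines $L^{(k+1)}$ is attained at every step) and, for all $k\ge 0$, $$\|L^{(k)}-L^*\|_F\le\Big(1-\frac{1-2C_1}{8}\,\eta\Big)^k\|L^{(0)}-L^*\|_F .$$ -/

import Mathlib

/- Norms of matrices are Frobenius norms throughout. -/
open scoped Matrix.Norms.Frobenius

namespace RobustPCA

/-- Real `n₁ × n₂` matrices. -/
abbrev Mat (n₁ n₂ : ℕ) : Type := Matrix (Fin n₁) (Fin n₂) ℝ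

/-- The Frobenius inner product. -/
def frobInner {n₁ n₂ : ℕ} (A B : Mat n₁ n₂) : ℝ :=
  ∑ i, ∑ j, A i j * B i j

/-! ### Assumptions on the sparse and on the low-rank part -/

/-- Each row of `S` has at most `γs * n₂` nonzero entries, and each column at most `γs * n₁`. -/
def IsSparse {n₁ n₂ : ℕ} (γs : ℝ) (S : Mat n₁ n₂) : Prop :=
  (∀ i, ((Finset.univ.filter fun j => S i j ≠ 0).card : ℝ) ≤ γs * n₂) ∧
    ∀ j, ((Finset.univ.filter fun i => S i j ≠ 0).card : ℝ) ≤ γs * n₁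

/-- `L = U * diag s * Vᵀ` is a compact singular value decomposition with `r` singular values. -/
structure IsSVD {n₁ n₂ r : ℕ} (L : Mat n₁ n₂) (U : Mat n₁ r) (s : Fin r → ℝ) (V : Mat n₂ r) :
    Prop where
  left_orthonormal : U.transpose * U = 1
  right_orthonormal : V.transpose * V = 1
  pos : ∀ k, 0 < s k
  antitone : Antitone s
  eq : L = U * Matrix.diagonal s * V.transpose

/-- `‖A‖_{2,∞} ≤ c`, where `‖A‖_{2,∞}` is the maximum of `‖A z‖_∞` over the vectors `z` of
Euclidean norm `1`. -/
def TwoInftyNormLE {n r : ℕ} (A : Mat n r) (c : ℝ) : Prop :=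
  ∀ z : EuclideanSpace ℝ (Fin r), ‖z‖ = 1 → ∀ i, |A.mulVec z.ofLp i| ≤ c

/-- `L` has a compact SVD of size `r` whose factors are `μ`-incoherent. (The condition does not
depend on the choice of the SVD.) -/
def IsIncoherent {n₁ n₂ : ℕ} (μ : ℝ) (r : ℕ) (L : Mat n₁ n₂) : Prop :=
  ∃ (U : Mat n₁ r) (s : Fin r → ℝ) (V : Mat n₂ r), IsSVD L U s V ∧
    TwoInftyNormLE U (Real.sqrt (μ * r / n₁)) ∧ TwoInftyNormLE V (Real.sqrt (μ * r / n₂))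

/-- The `r`-th largest singular value, `r ≥ 1` (Mathlib numbers the singular values from `0`). -/
noncomputable def singularValue {n₁ n₂ : ℕ} (r : ℕ) (L : Mat n₁ n₂) : ℝ :=
  (Matrix.toEuclideanLin L).singularValues (r - 1)

/-! ### Hard thresholding -/

/-- `t` is a threshold for the largest `γ`-fraction of the absolute values of the entries of `v`:
at most `γ n` of them exceed `t`, and at least `γ n` of them are `≥ t`. -/
def IsPercentile {n : ℕ} (γ : ℝ) (v : Fin n → ℝ) (t : ℝ) : Prop :=
  ((Finset.univ.filter fun j => t < |v j|).card : ℝ) ≤ γ * n ∧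
    γ * n ≤ ((Finset.univ.filter fun j => t ≤ |v j|).card : ℝ)

/-- `T` is a set of positions of the largest `γ`-fraction of the entries of `v` in absolute value:
all entries above the percentile belong to it, none of those below, and ties at the percentile are
broken arbitrarily, as long as `T` has at most `γ n` elements. -/
def IsTopFraction {n : ℕ} (γ : ℝ) (v : Fin n → ℝ) (T : Finset (Fin n)) : Prop :=
  (T.card : ℝ) ≤ γ * n ∧
    ∃ t, IsPercentile γ v t ∧ (∀ j, t < |v j| → j ∈ T) ∧ ∀ j ∈ T, t ≤ |v j|

/-- `G` is a value of the hard thresholding operator `F` at `A`: the entries that are among the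
largest `γ`-fraction both of their row and of their column are replaced by `0`, and the others are
kept. (It is a relation because of the freedom in breaking ties.) -/
def IsHardThreshold {n₁ n₂ : ℕ} (γ : ℝ) (A G : Mat n₁ n₂) : Prop :=
  ∃ (T : Fin n₁ → Finset (Fin n₂)) (T' : Fin n₂ → Finset (Fin n₁)),
    (∀ i, IsTopFraction γ (fun j => A i j) (T i)) ∧
    (∀ j, IsTopFraction γ (fun i => A i j) (T' j)) ∧
    ∀ i j, G i j = if j ∈ T i ∧ i ∈ T' j then 0 else A i j

/-! ### Geometry of the manifold of matrices of rank `r` -/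

/-- The tangent space at `X` of the manifold of matrices of the same rank as `X`. -/
def tangentSpace {n₁ n₂ : ℕ} (X : Mat n₁ n₂) : Set (Mat n₁ n₂) :=
  {W | ∃ (A : Mat n₁ n₁) (B : Mat n₂ n₂), W = A * X + X * B}

/-- `P` is the orthogonal projection of `G` to the tangent space at `X`. -/
def IsTangentProjection {n₁ n₂ : ℕ} (X G P : Mat n₁ n₂) : Prop :=
  P ∈ tangentSpace X ∧ ∀ W ∈ tangentSpace X, frobInner (G - P) W = 0

/-- `Z` is the projective retraction of `δ` at `X`: a matrix of rank `r` nearest to `X + δ`. -/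
def IsProjectiveRetraction {n₁ n₂ : ℕ} (r : ℕ) (X δ Z : Mat n₁ n₂) : Prop :=
  Z.rank = r ∧ ∀ Z' : Mat n₁ n₂, Z'.rank = r → ‖X + δ - Z‖ ≤ ‖X + δ - Z'‖

/-- `Z` is admissible for the orthographic retraction of `δ` at `X`: it has rank `r`, and
`Z - (X + δ)` is orthogonal to the tangent space at `X`. -/
def IsOrthographicAdmissible {n₁ n₂ : ℕ} (r : ℕ) (X δ Z : Mat n₁ n₂) : Prop :=
  Z.rank = r ∧ ∀ W ∈ tangentSpace X, frobInner (Z - X - δ) W = 0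

/-- `Z` is the orthographic retraction of `δ` at `X`: an admissible matrix nearest to `X + δ`. -/
def IsOrthographicRetraction {n₁ n₂ : ℕ} (r : ℕ) (X δ Z : Mat n₁ n₂) : Prop :=
  IsOrthographicAdmissible r X δ Z ∧
    ∀ Z' : Mat n₁ n₂, IsOrthographicAdmissible r X δ Z' → ‖X + δ - Z‖ ≤ ‖X + δ - Z'‖

/-! ### Riemannian gradient descent -/

/-- `X'` arises from `X` by a step of size `η` against the Riemannian gradient, the projection of
the Euclidean gradient `G` to the tangent space, followed by the retraction `R`. -/
def IsUpdate {n₁ n₂ : ℕ} (R : Mat n₁ n₂ → Mat n₁ n₂ → Mat n₁ n₂ → Prop) (η : ℝ)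
    (X G X' : Mat n₁ n₂) : Prop :=
  ∃ P, IsTangentProjection X G P ∧ R X (-(η • P)) X'

/-- One iteration of gradient descent for the observation `Y`: the Euclidean gradient at `X` is the
hard thresholding of `X - Y` at level `γ`. -/
def IsStep {n₁ n₂ : ℕ} (R : Mat n₁ n₂ → Mat n₁ n₂ → Mat n₁ n₂ → Prop) (γ η : ℝ)
    (Y X X' : Mat n₁ n₂) : Prop :=
  ∃ G, IsHardThreshold γ (X - Y) G ∧ IsUpdate R η X G X'

/-- Gradient descent can be continued from `X`: the gradient has a value, and, for each of its
values (that is, however ties are broken), so does the next iterate. -/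
def CanContinue {n₁ n₂ : ℕ} (R : Mat n₁ n₂ → Mat n₁ n₂ → Mat n₁ n₂ → Prop) (γ η : ℝ)
    (Y X : Mat n₁ n₂) : Prop :=
  (∃ G, IsHardThreshold γ (X - Y) G) ∧
    ∀ G, IsHardThreshold γ (X - Y) G → ∃ X', IsUpdate R η X G X'

end RobustPCA

namespace RobustPCA

open Matrix

/-! ### The Frobenius inner product -/

/-! Write `X` for an iterate and `D = X - Ls` for its error. The thresholded residual is nearly `D`:
`‖G - D‖ ≤ C₁ ‖D‖`. A removed position costs an entry of `D`; a corrupted position that is kept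
costs an entry of `D` plus an entry too small to be cut, hence bounded by row or column averages of
`D`. The positions charged to `D` are sparse in every row and column, so incoherence makes their
share of the tangential part of `D` at `Ls` small (`sum_weight_mul_sq_le`,
`norm_hardThreshold_sub_sq_le`).

The remaining part of `D`, normal at `Ls`, is quadratic in `D`: a rank-`r` matrix is determined by
its other three blocks, so its normal block is a product of two off-diagonal blocks and an inverse
(`eq_mul_inv_mul_of_rank_eq`, `norm_normal_le`). The same curvature bound at `X`, whose smallest
nonzero singular value exceeds `‖D‖`, shows that `D` is mostly tangent there. The Riemannian
gradient `P` therefore satisfies `⟨P, D⟩ ≥ (1 - 2 C₁) / 4 * ‖D‖²`.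

Thus the step before retraction shrinks the error to first order in `η`. The explicit rank-`r`
matrix of `exists_isOrthographicAdmissible` lies within `O(η²) ‖D‖` of the stepped point and
competes in both minimization problems, so either retraction costs only `O(η²) ‖D‖`; half of the
first-order gain pays for it. Minimizers exist because rank at most `r` is a closed condition, and
closeness to `Ls` prevents the rank from dropping. -/

theorem frobInner_eq_trace {m n : ℕ} (A B : Mat m n) : frobInner A B = trace (Aᵀ * B) := by
  simp only [frobInner, trace, diag, mul_apply, transpose_apply]
  exact Finset.sum_comm

theorem norm_sq_eq_sum {m n : ℕ} (A : Mat m n) : ‖A‖ ^ 2 = ∑ i, ∑ j, A i j ^ 2 := by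
  have h : 0 ≤ ∑ i, ∑ j, A i j ^ 2 :=
    Finset.sum_nonneg fun i _ => Finset.sum_nonneg fun j _ => sq_nonneg _
  rw [frobenius_norm_def]
  simp only [Real.rpow_two, Real.norm_eq_abs, sq_abs]
  rw [← Real.sqrt_eq_rpow, Real.sq_sqrt h]

theorem frobInner_self {m n : ℕ} (A : Mat m n) : frobInner A A = ‖A‖ ^ 2 := by
  rw [norm_sq_eq_sum, frobInner]; simp only [sq]

theorem frobInner_comm {m n : ℕ} (A B : Mat m n) : frobInner A B = frobInner B A := by
  simp only [frobInner, mul_comm]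

theorem frobInner_add_left {m n : ℕ} (A B C : Mat m n) :
    frobInner (A + B) C = frobInner A C + frobInner B C := by
  simp only [frobInner, Matrix.add_apply, add_mul, Finset.sum_add_distrib]

theorem frobInner_sub_left {m n : ℕ} (A B C : Mat m n) :
    frobInner (A - B) C = frobInner A C - frobInner B C := by
  simp only [frobInner, Matrix.sub_apply, sub_mul, Finset.sum_sub_distrib]

theorem frobInner_smul_left {m n : ℕ} (c : ℝ) (A B : Mat m n) :
    frobInner (c • A) B = c * frobInner A B := by
  simp only [frobInner, Matrix.smul_apply, smul_eq_mul, mul_assoc, Finset.mul_sum]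

theorem frobInner_add_right {m n : ℕ} (A B C : Mat m n) :
    frobInner A (B + C) = frobInner A B + frobInner A C := by
  simp only [frobInner_comm A, frobInner_add_left]

theorem frobInner_sub_right {m n : ℕ} (A B C : Mat m n) :
    frobInner A (B - C) = frobInner A B - frobInner A C := by
  simp only [frobInner_comm A, frobInner_sub_left]

theorem frobInner_smul_right {m n : ℕ} (c : ℝ) (A B : Mat m n) :
    frobInner A (c • B) = c * frobInner A B := by
  simp only [frobInner_comm A, frobInner_smul_left]

theorem frobInner_mul_left {m n p : ℕ} (A : Mat m n) (B : Mat n p) (C : Mat m p) :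
    frobInner (A * B) C = frobInner B (Aᵀ * C) := by
  simp only [frobInner_eq_trace, transpose_mul, Matrix.mul_assoc]

theorem frobInner_mul_right {m n p : ℕ} (A : Mat m n) (B : Mat n p) (C : Mat m p) :
    frobInner (A * B) C = frobInner A (C * Bᵀ) := by
  simp only [frobInner_eq_trace, transpose_mul]
  rw [Matrix.mul_assoc, trace_mul_comm, Matrix.mul_assoc]

theorem norm_add_sq_eq {m n : ℕ} (A B : Mat m n) :
    ‖A + B‖ ^ 2 = ‖A‖ ^ 2 + 2 * frobInner A B + ‖B‖ ^ 2 := by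
  rw [← frobInner_self, frobInner_add_left, frobInner_add_right, frobInner_add_right,
    frobInner_comm B A, frobInner_self, frobInner_self]
  ring

theorem abs_frobInner_le {m n : ℕ} (A B : Mat m n) : |frobInner A B| ≤ ‖A‖ * ‖B‖ := by
  apply abs_le_of_sq_le_sq _ (by positivity)
  rw [mul_pow, norm_sq_eq_sum, norm_sq_eq_sum, frobInner]
  simp only [← Finset.sum_product', Finset.univ_product_univ]
  exact Finset.sum_mul_sq_le_sq_mul_sq _ _ _

/-! ### Matrices with orthonormal columns -/

theorem norm_orthonormal_mul {n r m : ℕ} {U : Mat n r} (hU : Uᵀ * U = 1) (B : Mat r m) :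
    ‖U * B‖ = ‖B‖ := by
  rw [← sq_eq_sq₀ (norm_nonneg _) (norm_nonneg _), ← frobInner_self, frobInner_mul_left,
    ← Matrix.mul_assoc, hU, Matrix.one_mul, frobInner_self]

theorem norm_sq_split_left {n r m : ℕ} {U : Mat n r} (hU : Uᵀ * U = 1) (A : Mat n m) :
    ‖A‖ ^ 2 = ‖Uᵀ * A‖ ^ 2 + ‖(1 - U * Uᵀ) * A‖ ^ 2 := by
  have h : A = U * (Uᵀ * A) + (1 - U * Uᵀ) * A := by
    rw [Matrix.sub_mul, Matrix.one_mul, Matrix.mul_assoc]; abel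
  have h0 : Uᵀ * ((1 - U * Uᵀ) * A) = 0 := by
    rw [← Matrix.mul_assoc, Matrix.mul_sub, ← Matrix.mul_assoc, hU]; simp
  conv_lhs => rw [h]
  rw [norm_add_sq_eq, frobInner_mul_left, h0, norm_orthonormal_mul hU]
  simp [frobInner]

theorem norm_sq_split_right {n r m : ℕ} {V : Mat n r} (hV : Vᵀ * V = 1) (A : Mat m n) :
    ‖A‖ ^ 2 = ‖A * V‖ ^ 2 + ‖A * (1 - V * Vᵀ)‖ ^ 2 := by
  have h := norm_sq_split_left hV Aᵀ
  rw [← frobenius_norm_transpose (A * V), ← frobenius_norm_transpose (A * (1 - V * Vᵀ))]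
  simpa [transpose_mul] using h

theorem norm_transpose_mul_le {n r m : ℕ} {U : Mat n r} (hU : Uᵀ * U = 1) (A : Mat n m) :
    ‖Uᵀ * A‖ ≤ ‖A‖ := by
  have := norm_sq_split_left hU A
  exact le_of_sq_le_sq (by nlinarith [sq_nonneg ‖(1 - U * Uᵀ) * A‖]) (norm_nonneg _)

theorem norm_mul_orthonormal_le {n r m : ℕ} {V : Mat n r} (hV : Vᵀ * V = 1) (A : Mat m n) :
    ‖A * V‖ ≤ ‖A‖ := by
  have := norm_sq_split_right hV A
  exact le_of_sq_le_sq (by nlinarith [sq_nonneg ‖A * (1 - V * Vᵀ)‖]) (norm_nonneg _)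

theorem norm_compl_mul_le {n r m : ℕ} {U : Mat n r} (hU : Uᵀ * U = 1) (A : Mat n m) :
    ‖(1 - U * Uᵀ) * A‖ ≤ ‖A‖ := by
  have := norm_sq_split_left hU A
  exact le_of_sq_le_sq (by nlinarith [sq_nonneg ‖Uᵀ * A‖]) (norm_nonneg _)

theorem norm_mul_compl_le {n r m : ℕ} {V : Mat n r} (hV : Vᵀ * V = 1) (A : Mat m n) :
    ‖A * (1 - V * Vᵀ)‖ ≤ ‖A‖ := by
  have := norm_sq_split_right hV A
  exact le_of_sq_le_sq (by nlinarith [sq_nonneg ‖A * V‖]) (norm_nonneg _)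

/-- Pythagoras for the four blocks of `D` determined by orthonormal columns `U` and `V`. -/
theorem norm_sq_eq_sum_blocks {n₁ n₂ r : ℕ} {U : Mat n₁ r} {V : Mat n₂ r} (hU : Uᵀ * U = 1)
    (hV : Vᵀ * V = 1) (D : Mat n₁ n₂) :
    ‖D‖ ^ 2 = ‖Uᵀ * D * V‖ ^ 2 + ‖Uᵀ * D * (1 - V * Vᵀ)‖ ^ 2 +
      (‖(1 - U * Uᵀ) * D * V‖ ^ 2 + ‖(1 - U * Uᵀ) * D * (1 - V * Vᵀ)‖ ^ 2) := by
  rw [norm_sq_split_left hU, norm_sq_split_right hV (Uᵀ * D),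
    norm_sq_split_right hV ((1 - U * Uᵀ) * D)]

/-! ### Square matrices that are bounded below -/

/-- `σ` is a lower bound for the smallest singular value of the square matrix `M`. -/
def BoundedBelow {r : ℕ} (σ : ℝ) (M : Mat r r) : Prop :=
  ∀ (m : ℕ) (B : Mat r m), σ * ‖B‖ ≤ ‖M * B‖

theorem BoundedBelow.isUnit_det {r : ℕ} {σ : ℝ} {M : Mat r r} (h : BoundedBelow σ M)
    (hσ : 0 < σ) : IsUnit M.det := by
  rw [← isUnit_iff_isUnit_det, ← mulVec_injective_iff_isUnit]
  refine (injective_iff_map_eq_zero (mulVecLin M)).2 fun v hv => ?_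
  have h1 := h 1 (replicateCol (Fin 1) v)
  have h2 : M * replicateCol (Fin 1) v = 0 := by
    rw [← replicateCol_mulVec]
    have : M *ᵥ v = 0 := hv
    rw [this]; ext; simp
  rw [h2, norm_zero] at h1
  have h3 : ‖replicateCol (Fin 1) v‖ = 0 :=
    le_antisymm (by by_contra hc; push Not at hc; nlinarith [mul_pos hσ hc]) (norm_nonneg _)
  rw [norm_eq_zero] at h3
  ext i
  simpa using congrFun (congrFun h3 i) 0

theorem BoundedBelow.norm_inv_mul_le {r m : ℕ} {σ : ℝ} {M : Mat r r} (h : BoundedBelow σ M)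
    (hσ : 0 < σ) (B : Mat r m) : σ * ‖M⁻¹ * B‖ ≤ ‖B‖ := by
  have := h m (M⁻¹ * B)
  rwa [mul_nonsing_inv_cancel_left _ _ (h.isUnit_det hσ)] at this

theorem BoundedBelow.add {r : ℕ} {σ : ℝ} {M : Mat r r} (h : BoundedBelow σ M) (E : Mat r r) :
    BoundedBelow (σ - ‖E‖) (M + E) := fun m B => by
  have h1 := h m B
  have h2 : ‖M * B‖ ≤ ‖(M + E) * B‖ + ‖E * B‖ := by
    have : M * B = (M + E) * B - E * B := by rw [Matrix.add_mul]; abel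
    rw [this]; exact norm_sub_le _ _
  have h3 := frobenius_norm_mul E B
  linarith

theorem BoundedBelow.mono {r : ℕ} {σ τ : ℝ} {M : Mat r r} (h : BoundedBelow σ M) (hτ : τ ≤ σ) :
    BoundedBelow τ M := fun m B =>
  (mul_le_mul_of_nonneg_right hτ (norm_nonneg _)).trans (h m B)

theorem boundedBelow_diagonal {r : ℕ} {σ : ℝ} {s : Fin r → ℝ} (hσ : 0 ≤ σ) (h : ∀ k, σ ≤ s k) :
    BoundedBelow σ (diagonal s) := fun m B => by
  apply le_of_sq_le_sq _ (norm_nonneg _)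
  rw [mul_pow, norm_sq_eq_sum, norm_sq_eq_sum, Finset.mul_sum]
  refine Finset.sum_le_sum fun i _ => ?_
  rw [Finset.mul_sum]
  refine Finset.sum_le_sum fun j _ => ?_
  rw [diagonal_mul, mul_pow]
  gcongr
  exact h i

/-! ### Compact factorizations -/

/-- `X = U * M * Vᵀ` where `U` and `V` have orthonormal columns and `M` is bounded below by `σ`:
a compact singular value decomposition up to the choice of bases, of a matrix whose smallest
nonzero singular value is at least `σ`. -/
structure IsCompactFactorization {n₁ n₂ r : ℕ} (σ : ℝ) (X : Mat n₁ n₂) (U : Mat n₁ r)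
    (M : Mat r r) (V : Mat n₂ r) : Prop where
  left_orthonormal : Uᵀ * U = 1
  right_orthonormal : Vᵀ * V = 1
  boundedBelow : BoundedBelow σ M
  eq : X = U * M * Vᵀ

/-- The columns of `U` are an orthonormal basis of the column space of `X`; the second identity
expands each column of `X` in it. -/
theorem exists_orthonormal_columns {m n r : ℕ} {X : Mat m n} (hX : X.rank = r) :
    ∃ U : Mat m r, Uᵀ * U = 1 ∧ U * (Uᵀ * X) = X := by
  set K := LinearMap.range (toEuclideanLin X) with hK
  have hdim : Module.finrank ℝ K = r := by
    rw [← hX, rank_eq_finrank_range_toLin X (EuclideanSpace.basisFun _ ℝ).toBasis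
      (EuclideanSpace.basisFun _ ℝ).toBasis, hK, toEuclideanLin_eq_toLin_orthonormal]
  obtain ⟨b⟩ : Nonempty (OrthonormalBasis (Fin r) ℝ K) :=
    ⟨(stdOrthonormalBasis ℝ K).reindex (finCongr hdim)⟩
  have hb : ∀ k l, ∑ i, (b k : EuclideanSpace ℝ (Fin m)) i * (b l : EuclideanSpace ℝ (Fin m)) i
      = if k = l then 1 else 0 := by
    intro k l
    have := orthonormal_iff_ite.1 b.orthonormal k l
    rw [← this, Submodule.coe_inner, PiLp.inner_apply]
    exact Finset.sum_congr rfl fun i _ => mul_comm _ _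
  refine ⟨of fun i k => (b k : EuclideanSpace ℝ (Fin m)) i, ?_, ?_⟩
  · ext k l
    simp [mul_apply, hb, one_apply]
  · ext i j
    let y : K := ⟨toEuclideanLin X (EuclideanSpace.single j 1), LinearMap.mem_range_self _ _⟩
    have hy : ∀ i, (y : EuclideanSpace ℝ (Fin m)) i = X i j := by
      intro i; simp [y, toLpLin_apply]
    have h := congrArg (fun z : K => (z : EuclideanSpace ℝ (Fin m)) i) (b.sum_repr' y)
    simp only [Submodule.coe_sum, Submodule.coe_smul, hy, Submodule.coe_inner, PiLp.inner_apply] at h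
    rw [← h]
    simp [mul_apply, mul_comm]

theorem rank_le_of_eq_mul {m n r : ℕ} (A : Mat m r) (B : Mat r n) : (A * B).rank ≤ r :=
  (rank_mul_le_left A B).trans ((rank_le_card_width A).trans (by simp))

/-- A lower bound for the compressed matrix `Uᵀ * Z * V` forces the rank of `Z` to be at least the
number of columns of `U` and `V`. -/
theorem le_rank_of_boundedBelow {n₁ n₂ r : ℕ} {σ : ℝ} {Z : Mat n₁ n₂} {U : Mat n₁ r} {V : Mat n₂ r}
    (h : BoundedBelow σ (Uᵀ * Z * V)) (hσ : 0 < σ) : r ≤ Z.rank := by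
  have h1 := rank_of_isUnit _ ((isUnit_iff_isUnit_det _).2 (h.isUnit_det hσ))
  simp only [Fintype.card_fin] at h1
  calc r = (Uᵀ * Z * V).rank := h1.symm
    _ ≤ (Uᵀ * Z).rank := rank_mul_le_left _ _
    _ ≤ Z.rank := rank_mul_le_right _ _

/-- A matrix `Z` of rank `r` is determined by its blocks `Z * V` and `Uᵀ * Z` as soon as
`Uᵀ * Z * V` is invertible. -/
theorem eq_mul_inv_mul_of_rank_eq {n₁ n₂ r : ℕ} {Z : Mat n₁ n₂} {U : Mat n₁ r} {V : Mat n₂ r}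
    (hZ : Z.rank = r)
    (hN : IsUnit (Uᵀ * Z * V).det) : Z = Z * V * (Uᵀ * Z * V)⁻¹ * (Uᵀ * Z) := by
  obtain ⟨W, -, hW⟩ := exists_orthonormal_columns hZ
  set C := Wᵀ * Z with hC
  have hNe : Uᵀ * Z * V = (Uᵀ * W) * (C * V) := by
    conv_lhs => rw [← hW]
    simp only [Matrix.mul_assoc]
  have hdet : IsUnit ((Uᵀ * W).det * (C * V).det) := by rwa [← det_mul, ← hNe]
  have h1 := isUnit_of_mul_isUnit_left hdet
  have h2 := isUnit_of_mul_isUnit_right hdet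
  calc Z = W * C := hW.symm
    _ = W * ((C * V) * (C * V)⁻¹) * ((Uᵀ * W)⁻¹ * (Uᵀ * W)) * C := by
      rw [mul_nonsing_inv _ h2, nonsing_inv_mul _ h1]; simp
    _ = (W * C) * V * (Uᵀ * Z * V)⁻¹ * (Uᵀ * (W * C)) := by
      rw [hNe, Matrix.mul_inv_rev]; simp only [Matrix.mul_assoc]
    _ = _ := by rw [hW]

namespace IsCompactFactorization

variable {n₁ n₂ r : ℕ} {σ : ℝ} {X Z : Mat n₁ n₂} {U : Mat n₁ r} {M : Mat r r} {V : Mat n₂ r}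

theorem compress (h : IsCompactFactorization σ X U M V) : Uᵀ * X * V = M := by
  calc Uᵀ * X * V = (Uᵀ * U) * M * (Vᵀ * V) := by rw [h.eq]; simp only [Matrix.mul_assoc]
    _ = M := by rw [h.left_orthonormal, h.right_orthonormal]; simp

theorem compl_mul (h : IsCompactFactorization σ X U M V) : (1 - U * Uᵀ) * X = 0 := by
  have : (1 - U * Uᵀ) * X = (U - U * (Uᵀ * U)) * M * Vᵀ := by
    rw [h.eq]; simp only [Matrix.sub_mul, Matrix.one_mul, Matrix.mul_assoc]
  rw [this, h.left_orthonormal]; simp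

theorem mul_compl (h : IsCompactFactorization σ X U M V) : X * (1 - V * Vᵀ) = 0 := by
  have : X * (1 - V * Vᵀ) = U * M * (Vᵀ - (Vᵀ * V) * Vᵀ) := by
    rw [h.eq]; simp only [Matrix.mul_sub, Matrix.mul_one, Matrix.mul_assoc]
  rw [this, h.right_orthonormal]; simp

theorem boundedBelow_compress (h : IsCompactFactorization σ X U M V) (Z : Mat n₁ n₂) :
    BoundedBelow (σ - ‖Uᵀ * (Z - X) * V‖) (Uᵀ * Z * V) := by
  have : Uᵀ * Z * V = M + Uᵀ * (Z - X) * V := by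
    rw [Matrix.mul_sub, Matrix.sub_mul, h.compress]; abel
  rw [this]
  exact h.boundedBelow.add _

theorem norm_compress_le (h : IsCompactFactorization σ X U M V) (D : Mat n₁ n₂) :
    ‖Uᵀ * D * V‖ ≤ ‖D‖ :=
  (norm_mul_orthonormal_le h.right_orthonormal _).trans
    (norm_transpose_mul_le h.left_orthonormal _)

theorem le_rank (h : IsCompactFactorization σ X U M V) (hZ : ‖Z - X‖ < σ) : r ≤ Z.rank :=
  le_rank_of_boundedBelow (h.boundedBelow_compress Z)
    (by linarith [h.norm_compress_le (Z - X)])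

/-- A matrix of rank `r` near a matrix with a compact factorization has such a factorization. -/
theorem exists_of_rank_eq (h : IsCompactFactorization σ X U M V) (hZ : Z.rank = r)
    (hd : ‖Z - X‖ < σ) : ∃ (U' : Mat n₁ r) (M' : Mat r r) (V' : Mat n₂ r),
      IsCompactFactorization (σ - ‖Z - X‖) Z U' M' V' := by
  obtain ⟨U', hU', hUZ⟩ := exists_orthonormal_columns hZ
  obtain ⟨V', hV', hVZ⟩ := exists_orthonormal_columns ((rank_transpose Z).trans hZ)
  have hVZ' : Z * V' * V'ᵀ = Z := by
    have := congrArg transpose hVZ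
    simpa [transpose_mul] using this
  have heq : Z = U' * (U'ᵀ * Z * V') * V'ᵀ := by
    calc Z = U' * (U'ᵀ * (Z * V' * V'ᵀ)) := by rw [hVZ', hUZ]
      _ = _ := by simp only [Matrix.mul_assoc]
  refine ⟨U', U'ᵀ * Z * V', V', hU', hV', ?_, heq⟩
  set M' := U'ᵀ * Z * V' with hM'
  set τ := σ - ‖Z - X‖ with hτ
  have hτ0 : 0 < τ := by linarith
  -- Weyl's perturbation argument on the range of `V`: there `X` stretches by at least `σ`, and
  -- replacing `X` by `Z` loses at most `‖Z - X‖`. The factor `V'ᵀ * V`, a contraction, changes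
  -- bases; it is shown to be invertible and then removed.
  have key : ∀ (m : ℕ) (B : Mat r m), τ * ‖B‖ ≤ ‖M' * (V'ᵀ * V * B)‖ := by
    intro m B
    have h1 : ‖M' * (V'ᵀ * V * B)‖ = ‖Z * (V * B)‖ := by
      rw [← norm_orthonormal_mul hU' (M' * (V'ᵀ * V * B))]
      congr 1
      conv_rhs => rw [heq]
      simp only [Matrix.mul_assoc]
    have h2 : ‖X * (V * B)‖ = ‖M * B‖ := by
      rw [← norm_orthonormal_mul h.left_orthonormal (M * B)]
      congr 1
      calc X * (V * B) = U * M * (Vᵀ * V) * B := by rw [h.eq]; simp only [Matrix.mul_assoc]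
        _ = _ := by rw [h.right_orthonormal, Matrix.mul_one, Matrix.mul_assoc]
    have h3 : ‖X * (V * B)‖ ≤ ‖Z * (V * B)‖ + ‖Z - X‖ * ‖B‖ := by
      have : X * (V * B) = Z * (V * B) - (Z - X) * (V * B) := by rw [Matrix.sub_mul]; abel
      rw [this]
      refine (norm_sub_le _ _).trans ?_
      gcongr
      rw [← norm_orthonormal_mul h.right_orthonormal B]
      exact frobenius_norm_mul _ _
    have h4 := h.boundedBelow m B
    rw [h1, hτ]
    linarith
  have hle : ∀ (m : ℕ) (B : Mat r m), ‖V'ᵀ * V * B‖ ≤ ‖B‖ := fun m B => by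
    rw [Matrix.mul_assoc]
    exact (norm_transpose_mul_le hV' _).trans (norm_orthonormal_mul h.right_orthonormal B).le
  have hunit : IsUnit (M' * (V'ᵀ * V)).det :=
    BoundedBelow.isUnit_det (σ := τ) (fun m B => by
      rw [Matrix.mul_assoc]; exact key m B) hτ0
  rw [det_mul] at hunit
  have hW := isUnit_of_mul_isUnit_right hunit
  intro m B
  have h1 := key m ((V'ᵀ * V)⁻¹ * B)
  have h2 := hle m ((V'ᵀ * V)⁻¹ * B)
  rw [mul_nonsing_inv_cancel_left _ _ hW] at h1 h2
  exact (mul_le_mul_of_nonneg_left h2 hτ0.le).trans h1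

/-- The normal component of the difference of two matrices of rank `r` is of second order. -/
theorem norm_normal_le (h : IsCompactFactorization σ X U M V) (hZ : Z.rank = r)
    (hd : ‖Z - X‖ < σ) :
    2 * σ * ‖(1 - U * Uᵀ) * (Z - X) * (1 - V * Vᵀ)‖ ≤ ‖Z - X‖ ^ 2 := by
  set D := Z - X with hD
  have hx := h.norm_compress_le D
  have hb := h.boundedBelow_compress Z
  rw [← hD] at hb
  have hpos : 0 < σ - ‖Uᵀ * D * V‖ := by linarith
  have hN := hb.isUnit_det hpos
  have hZe := eq_mul_inv_mul_of_rank_eq hZ hN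
  have hPD : (1 - U * Uᵀ) * D = (1 - U * Uᵀ) * Z := by rw [hD, Matrix.mul_sub, h.compl_mul, sub_zero]
  have hDQ : D * (1 - V * Vᵀ) = Z * (1 - V * Vᵀ) := by
    rw [hD, Matrix.sub_mul, h.mul_compl, sub_zero]
  -- `X` has no component under either complementary projection, so `D` may replace `Z` in the outer
  -- blocks. The normal block becomes a product of two blocks of first order.
  have heq : (1 - U * Uᵀ) * D * (1 - V * Vᵀ) =
      ((1 - U * Uᵀ) * D * V) * ((Uᵀ * Z * V)⁻¹ * (Uᵀ * D * (1 - V * Vᵀ))) := by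
    calc (1 - U * Uᵀ) * D * (1 - V * Vᵀ) = (1 - U * Uᵀ) * Z * (1 - V * Vᵀ) := by rw [hPD]
      _ = (1 - U * Uᵀ) * (Z * V * (Uᵀ * Z * V)⁻¹ * (Uᵀ * Z)) * (1 - V * Vᵀ) := by rw [← hZe]
      _ = ((1 - U * Uᵀ) * Z * V) * ((Uᵀ * Z * V)⁻¹ * (Uᵀ * (Z * (1 - V * Vᵀ)))) := by
        simp only [Matrix.mul_assoc]
      _ = _ := by rw [← hPD, ← hDQ]; simp only [Matrix.mul_assoc]
  have h1 : ‖(1 - U * Uᵀ) * D * (1 - V * Vᵀ)‖ ≤ ‖(1 - U * Uᵀ) * D * V‖ *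
      ‖(Uᵀ * Z * V)⁻¹ * (Uᵀ * D * (1 - V * Vᵀ))‖ := by
    conv_lhs => rw [heq]
    exact frobenius_norm_mul _ _
  have h2 := hb.norm_inv_mul_le hpos (Uᵀ * D * (1 - V * Vᵀ))
  have h3 := norm_sq_eq_sum_blocks h.left_orthonormal h.right_orthonormal D
  set x := ‖Uᵀ * D * V‖
  set y := ‖Uᵀ * D * (1 - V * Vᵀ)‖
  set y' := ‖(1 - U * Uᵀ) * D * V‖
  set z := ‖(1 - U * Uᵀ) * D * (1 - V * Vᵀ)‖
  set w := ‖(Uᵀ * Z * V)⁻¹ * (Uᵀ * D * (1 - V * Vᵀ))‖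
  have hy' : 0 ≤ y' := norm_nonneg _
  have h4 : (σ - x) * z ≤ y' * y := by
    calc (σ - x) * z ≤ (σ - x) * (y' * w) := by gcongr
      _ = y' * ((σ - x) * w) := by ring
      _ ≤ y' * y := by gcongr
  -- `2σz ≤ 2xz + 2yy' ≤ x² + z² + y² + y'²`, which is `‖D‖²` by Pythagoras.
  nlinarith [sq_nonneg (x - z), sq_nonneg (y - y')]

end IsCompactFactorization

/-! ### Singular values -/

/-- On the orthogonal complement of its kernel, a linear map is bounded below by its last nonzero
singular value. -/
theorem singularValues_mul_norm_le {E F : Type*} [NormedAddCommGroup E] [InnerProductSpace ℝ E]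
    [FiniteDimensional ℝ E] [NormedAddCommGroup F] [InnerProductSpace ℝ F] [FiniteDimensional ℝ F]
    (T : E →ₗ[ℝ] F) {x : E} (hx : x ∈ (LinearMap.ker T)ᗮ) :
    T.singularValues (Module.finrank ℝ (LinearMap.range T) - 1) * ‖x‖ ≤ ‖T x‖ := by
  set σ := T.singularValues (Module.finrank ℝ (LinearMap.range T) - 1) with hσ
  have hT := T.isSymmetric_adjoint_comp_self
  let b := hT.eigenvectorBasis rfl
  have hb : ∀ i, (LinearMap.adjoint T ∘ₗ T) (b i) = (T.singularValues i ^ 2) • b i := by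
    intro i
    rw [T.sq_singularValues_fin rfl i]
    exact hT.apply_eigenvectorBasis rfl i
  have hT2 : ∀ y z : E, inner ℝ (T y) (T z) = inner ℝ ((LinearMap.adjoint T ∘ₗ T) y) z := by
    intro y z
    rw [LinearMap.comp_apply, LinearMap.adjoint_inner_left]
  have hnorm : ‖T x‖ ^ 2 = ∑ i : Fin (Module.finrank ℝ E), T.singularValues i ^ 2 * inner ℝ (b i) x ^ 2 := by
    rw [← real_inner_self_eq_norm_sq, hT2, ← b.sum_inner_mul_inner]
    refine Finset.sum_congr rfl fun i _ => ?_
    rw [hT x (b i), hb i, real_inner_smul_right, real_inner_comm]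
    ring
  apply le_of_sq_le_sq _ (norm_nonneg _)
  rw [hnorm, mul_pow, ← b.sum_sq_inner_right x, Finset.mul_sum]
  refine Finset.sum_le_sum fun i _ => ?_
  by_cases hi : (i : ℕ) < Module.finrank ℝ (LinearMap.range T)
  · gcongr
    · exact T.singularValues_nonneg _
    · exact T.singularValues_antitone (by omega)
  -- Beyond the rank the eigenvectors lie in the kernel, so `x` has no coefficient along them.
  · have h0 : T.singularValues i = 0 :=
      T.singularValues_eq_zero_iff_le_finrank_range.2 (not_lt.1 hi)
    have hk : b i ∈ LinearMap.ker T := by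
      rw [LinearMap.mem_ker, ← inner_self_eq_zero (𝕜 := ℝ), hT2, hb, h0]
      simp
    rw [hx _ hk]
    simp

theorem finrank_range_toEuclideanLin {m n : ℕ} (X : Mat m n) :
    Module.finrank ℝ (LinearMap.range (toEuclideanLin X)) = X.rank := by
  rw [rank_eq_finrank_range_toLin X (EuclideanSpace.basisFun _ ℝ).toBasis
    (EuclideanSpace.basisFun _ ℝ).toBasis, toEuclideanLin_eq_toLin_orthonormal]

theorem singularValue_pos {n₁ n₂ r : ℕ} (hr : 1 ≤ r) {L : Mat n₁ n₂} (hL : L.rank = r) :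
    0 < singularValue r L := by
  rw [singularValue, LinearMap.singularValues_pos_iff_lt_finrank_range,
    finrank_range_toEuclideanLin, hL]
  omega

/-- Testing on the right singular vector `V e_k`: it is a unit vector orthogonal to the kernel of
`L`, and its image has norm `s k`. This links the given decomposition to the intrinsic singular
value without a uniqueness theorem. -/
theorem singularValue_le_of_isSVD {n₁ n₂ r : ℕ} {L : Mat n₁ n₂} (hL : L.rank = r) {U : Mat n₁ r}
    {s : Fin r → ℝ} {V : Mat n₂ r} (h : IsSVD L U s V) (k : Fin r) : singularValue r L ≤ s k := by
  have hmul : ∀ y : Fin n₂ → ℝ, L *ᵥ y = U *ᵥ (fun l => s l * (Vᵀ *ᵥ y) l) := by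
    intro y
    rw [h.eq, ← mulVec_mulVec, ← mulVec_mulVec]
    congr 1
    ext l
    rw [mulVec_diagonal]
  have hUU : ∀ z, Uᵀ *ᵥ (U *ᵥ z) = z := fun z => by
    rw [mulVec_mulVec, h.left_orthonormal, one_mulVec]
  have hVk : Vᵀ *ᵥ (V *ᵥ Pi.single k 1) = Pi.single k 1 := by
    rw [mulVec_mulVec, h.right_orthonormal, one_mulVec]
  let x : EuclideanSpace ℝ (Fin n₂) := WithLp.toLp 2 (V *ᵥ Pi.single k 1)
  have hiso : ∀ {n : ℕ} {W : Mat n r}, Wᵀ * W = 1 → ∀ z : Fin r → ℝ,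
      ‖WithLp.toLp 2 (W *ᵥ z)‖ = ‖WithLp.toLp 2 z‖ := by
    intro n W hW z
    rw [← frobenius_norm_replicateCol (ι := Fin 1), ← frobenius_norm_replicateCol (ι := Fin 1),
      replicateCol_mulVec]
    exact norm_orthonormal_mul hW _
  have hx : x ∈ (LinearMap.ker (toEuclideanLin L))ᗮ := by
    intro y hy
    have hy' : L *ᵥ y.ofLp = 0 := by
      have := congrArg WithLp.ofLp (LinearMap.mem_ker.1 hy)
      simpa [toLpLin_apply] using this
    have h1 : (fun l => s l * (Vᵀ *ᵥ y.ofLp) l) = 0 := by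
      rw [← hUU (fun l => s l * (Vᵀ *ᵥ y.ofLp) l), ← hmul, hy', mulVec_zero]
    have h2 : (Vᵀ *ᵥ y.ofLp) k = 0 := by
      have := congrFun h1 k
      simpa [(h.pos k).ne'] using this
    simpa [x, PiLp.inner_apply, mulVec, dotProduct, mul_comm] using h2
  have key := singularValues_mul_norm_le (toEuclideanLin L) hx
  have hn : ‖x‖ = 1 := by
    rw [hiso h.right_orthonormal]
    simp
  have hLx : ‖toEuclideanLin L x‖ = s k := by
    rw [toLpLin_apply]
    simp only [x]
    rw [hmul, hVk, hiso h.left_orthonormal]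
    have : (fun l => s l * (Pi.single k (1 : ℝ) : Fin r → ℝ) l) = Pi.single k (s k) := by
      ext l
      by_cases hl : l = k
      · subst hl; simp
      · simp [hl]
    rw [this]
    simp [abs_of_pos (h.pos k)]
  rw [hn, hLx, mul_one, finrank_range_toEuclideanLin, hL] at key
  exact key

theorem IsSVD.isCompactFactorization {n₁ n₂ r : ℕ} (hr : 1 ≤ r) {L : Mat n₁ n₂} (hL : L.rank = r)
    {U : Mat n₁ r} {s : Fin r → ℝ} {V : Mat n₂ r} (h : IsSVD L U s V) :
    IsCompactFactorization (singularValue r L) L U (diagonal s) V :=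
  ⟨h.left_orthonormal, h.right_orthonormal,
    boundedBelow_diagonal (singularValue_pos hr hL).le (singularValue_le_of_isSVD hL h), h.eq⟩

/-! ### The tangent space -/

theorem frobInner_eq_zero_of_mem_tangentSpace {n₁ n₂ r : ℕ} {σ : ℝ} {X : Mat n₁ n₂} {U : Mat n₁ r}
    {M : Mat r r} {V : Mat n₂ r} (h : IsCompactFactorization σ X U M V) {E W : Mat n₁ n₂}
    (hU : Uᵀ * E = 0) (hV : E * V = 0) (hW : W ∈ tangentSpace X) : frobInner E W = 0 := by
  obtain ⟨A, B, rfl⟩ := hW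
  have h1 : frobInner (A * X) E = 0 := by
    rw [frobInner_mul_right, h.eq, transpose_mul, transpose_transpose, ← Matrix.mul_assoc, hV]
    simp [frobInner]
  have h2 : frobInner (X * B) E = 0 := by
    rw [frobInner_mul_left, h.eq, transpose_mul, transpose_mul]
    simp only [Matrix.mul_assoc]
    rw [hU]
    simp [frobInner]
  rw [frobInner_add_right, frobInner_comm, h1, frobInner_comm, h2, add_zero]

namespace IsCompactFactorization

variable {n₁ n₂ r : ℕ} {σ : ℝ} {X Z : Mat n₁ n₂} {U : Mat n₁ r} {M : Mat r r} {V : Mat n₂ r}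

theorem transpose_mul_compl (h : IsCompactFactorization σ X U M V) : Uᵀ * (1 - U * Uᵀ) = 0 := by
  rw [Matrix.mul_sub, ← Matrix.mul_assoc, h.left_orthonormal]; simp

theorem compl_mul_right (h : IsCompactFactorization σ X U M V) : (1 - V * Vᵀ) * V = 0 := by
  rw [Matrix.sub_mul, Matrix.mul_assoc, h.right_orthonormal]; simp

theorem isTangentProjection (h : IsCompactFactorization σ X U M V) (hσ : 0 < σ) (G : Mat n₁ n₂) :
    IsTangentProjection X G (G - (1 - U * Uᵀ) * G * (1 - V * Vᵀ)) := by
  have hM := h.boundedBelow.isUnit_det hσ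
  constructor
  -- The inverse `M⁻¹` undoes the core of `X`, so the two products are `(1 - U Uᵀ) G V Vᵀ` and `U Uᵀ
  -- G`; their sum is `G` without its normal block.
  · refine ⟨(1 - U * Uᵀ) * G * V * M⁻¹ * Uᵀ, V * M⁻¹ * Uᵀ * G, ?_⟩
    have h1 : (1 - U * Uᵀ) * G * V * M⁻¹ * Uᵀ * X = (1 - U * Uᵀ) * G * (V * Vᵀ) := by
      calc _ = (1 - U * Uᵀ) * G * V * (M⁻¹ * ((Uᵀ * U) * M)) * Vᵀ := by
            conv_lhs => rw [h.eq]
            simp only [Matrix.mul_assoc]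
        _ = _ := by
            rw [h.left_orthonormal, Matrix.one_mul, nonsing_inv_mul _ hM, Matrix.mul_one]
            simp only [Matrix.mul_assoc]
    have h2 : X * (V * M⁻¹ * Uᵀ * G) = U * Uᵀ * G := by
      calc _ = U * ((M * (Vᵀ * V)) * M⁻¹) * Uᵀ * G := by
            conv_lhs => rw [h.eq]
            simp only [Matrix.mul_assoc]
        _ = _ := by rw [h.right_orthonormal, Matrix.mul_one, mul_nonsing_inv _ hM, Matrix.mul_one]
    rw [h1, h2]
    simp only [Matrix.mul_sub, Matrix.sub_mul, Matrix.mul_one, Matrix.one_mul]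
    abel
  · intro W hW
    rw [sub_sub_cancel]
    refine frobInner_eq_zero_of_mem_tangentSpace h ?_ ?_ hW
    · rw [Matrix.mul_assoc, ← Matrix.mul_assoc, h.transpose_mul_compl, Matrix.zero_mul]
    · rw [Matrix.mul_assoc, h.compl_mul_right, Matrix.mul_zero]

theorem normal_eq_zero_of_mem_tangentSpace (h : IsCompactFactorization σ X U M V)
    {W : Mat n₁ n₂} (hW : W ∈ tangentSpace X) : (1 - U * Uᵀ) * W * (1 - V * Vᵀ) = 0 := by
  obtain ⟨A, B, rfl⟩ := hW
  rw [Matrix.mul_add, Matrix.add_mul, ← Matrix.mul_assoc, ← Matrix.mul_assoc, h.compl_mul,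
    Matrix.mul_assoc, h.mul_compl]
  simp

/-- For a small tangent vector `δ` there is a matrix of rank `r` whose difference from `X + δ` is
normal and of second order. -/
theorem exists_isOrthographicAdmissible (h : IsCompactFactorization σ X U M V) {δ : Mat n₁ n₂}
    (hδ : δ ∈ tangentSpace X) (hlt : ‖δ‖ < σ) :
    ∃ Z, IsOrthographicAdmissible r X δ Z ∧ (σ - ‖δ‖) * ‖X + δ - Z‖ ≤ ‖δ‖ ^ 2 := by
  set H := X + δ with hH
  set N := Uᵀ * H * V with hN
  have hb : BoundedBelow (σ - ‖δ‖) N := by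
    have h1 := h.boundedBelow_compress H
    have h2 := h.norm_compress_le δ
    rw [hH, add_sub_cancel_left] at h1
    exact h1.mono (by linarith)
  have hpos : 0 < σ - ‖δ‖ := by linarith
  have hu := hb.isUnit_det hpos
  -- The rank-`r` matrix sharing the blocks `H * V` and `Uᵀ * H` with `H`. Only the normal block
  -- changes, from zero to a product quadratic in `δ`.
  set Z := H * V * N⁻¹ * (Uᵀ * H) with hZ
  have hZV : Z * V = H * V := by
    calc Z * V = H * V * (N⁻¹ * N) := by rw [hZ, hN]; simp only [Matrix.mul_assoc]
      _ = H * V := by rw [nonsing_inv_mul _ hu, Matrix.mul_one]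
  have hUZ : Uᵀ * Z = Uᵀ * H := by
    calc Uᵀ * Z = (N * N⁻¹) * (Uᵀ * H) := by rw [hZ, hN]; simp only [Matrix.mul_assoc]
      _ = Uᵀ * H := by rw [mul_nonsing_inv _ hu, Matrix.one_mul]
  have hrank : Z.rank = r := by
    refine le_antisymm (rank_le_of_eq_mul _ _) ?_
    refine le_rank_of_boundedBelow (σ := σ - ‖δ‖) (U := U) (V := V) ?_ hpos
    rwa [hUZ]
  have hUE : Uᵀ * (Z - H) = 0 := by rw [Matrix.mul_sub, hUZ, sub_self]
  have hEV : (Z - H) * V = 0 := by rw [Matrix.sub_mul, hZV, sub_self]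
  refine ⟨Z, ⟨hrank, fun W hW => ?_⟩, ?_⟩
  · rw [sub_sub, ← hH]
    exact frobInner_eq_zero_of_mem_tangentSpace h hUE hEV hW
  · have hPH : (1 - U * Uᵀ) * H = (1 - U * Uᵀ) * δ := by
      rw [hH, Matrix.mul_add, h.compl_mul, zero_add]
    have hHQ : H * (1 - V * Vᵀ) = δ * (1 - V * Vᵀ) := by
      rw [hH, Matrix.add_mul, h.mul_compl, zero_add]
    have hE : Z - H = (1 - U * Uᵀ) * (Z - H) * (1 - V * Vᵀ) := by
      rw [Matrix.sub_mul 1, Matrix.one_mul, Matrix.mul_assoc, hUE, Matrix.mul_zero, sub_zero,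
        Matrix.mul_sub, Matrix.mul_one, ← Matrix.mul_assoc, hEV, Matrix.zero_mul, sub_zero]
    have hE' : Z - H = ((1 - U * Uᵀ) * δ * V) * (N⁻¹ * (Uᵀ * (δ * (1 - V * Vᵀ)))) := by
      calc Z - H = (1 - U * Uᵀ) * Z * (1 - V * Vᵀ) - (1 - U * Uᵀ) * H * (1 - V * Vᵀ) := by
            rw [← Matrix.sub_mul, ← Matrix.mul_sub]; exact hE
        _ = (1 - U * Uᵀ) * Z * (1 - V * Vᵀ) := by
            rw [hPH, h.normal_eq_zero_of_mem_tangentSpace hδ, sub_zero]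
        _ = ((1 - U * Uᵀ) * H) * V * (N⁻¹ * (Uᵀ * (H * (1 - V * Vᵀ)))) := by
            rw [hZ]; simp only [Matrix.mul_assoc]
        _ = _ := by rw [hPH, hHQ]
    have h1 : ‖(1 - U * Uᵀ) * δ * V‖ ≤ ‖δ‖ :=
      (norm_mul_orthonormal_le h.right_orthonormal _).trans
        (norm_compl_mul_le h.left_orthonormal _)
    have h2 : ‖Uᵀ * (δ * (1 - V * Vᵀ))‖ ≤ ‖δ‖ :=
      (norm_transpose_mul_le h.left_orthonormal _).trans
        (norm_mul_compl_le h.right_orthonormal _)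
    have h3 := hb.norm_inv_mul_le hpos (Uᵀ * (δ * (1 - V * Vᵀ)))
    rw [norm_sub_rev, hE']
    calc _ ≤ (σ - ‖δ‖) * (‖(1 - U * Uᵀ) * δ * V‖ * ‖N⁻¹ * (Uᵀ * (δ * (1 - V * Vᵀ)))‖) := by
          gcongr; exact frobenius_norm_mul _ _
      _ = ‖(1 - U * Uᵀ) * δ * V‖ * ((σ - ‖δ‖) * ‖N⁻¹ * (Uᵀ * (δ * (1 - V * Vᵀ)))‖) := by ring
      _ ≤ ‖δ‖ * ‖δ‖ := by gcongr; exact h3.trans h2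
      _ = ‖δ‖ ^ 2 := by ring

end IsCompactFactorization

/-! ### Existence of nearest matrices of bounded rank -/

/-- Lower semicontinuity of the rank: the operators of rank at least `r + 1` form an open set. -/
theorem isClosed_setOf_rank_le (n₁ n₂ r : ℕ) : IsClosed {Z : Mat n₁ n₂ | Z.rank ≤ r} := by
  let f : Mat n₁ n₂ →ₗ[ℝ] (EuclideanSpace ℝ (Fin n₂) →L[ℝ] EuclideanSpace ℝ (Fin n₁)) :=
    (LinearMap.toContinuousLinearMap (𝕜 := ℝ) (E := EuclideanSpace ℝ (Fin n₂))
      (F' := EuclideanSpace ℝ (Fin n₁))).toLinearMap ∘ₗ (toEuclideanLin (𝕜 := ℝ)).toLinearMap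
  have hf : Continuous f := f.continuous_of_finiteDimensional
  have ho := (isOpen_setOfPred_nat_le_rank (𝕜 := ℝ) (E := EuclideanSpace ℝ (Fin n₂))
    (F := EuclideanSpace ℝ (Fin n₁)) (r + 1)).preimage hf
  rw [← isOpen_compl_iff]
  convert ho using 1
  ext Z
  have : ((f Z : EuclideanSpace ℝ (Fin n₂) →ₗ[ℝ] EuclideanSpace ℝ (Fin n₁))).rank = Z.rank := by
    rw [← finrank_range_toEuclideanLin, LinearMap.rank, Module.finrank_eq_rank]
    rfl
  simp only [Set.mem_compl_iff, Set.mem_ofPred_eq, not_le, Set.mem_preimage, this]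
  rw [Nat.cast_le]
  rfl

theorem exists_nearest_of_isClosed {n₁ n₂ r : ℕ} {K : Set (Mat n₁ n₂)} (hK : IsClosed K)
    {H Z : Mat n₁ n₂} (hZ : Z ∈ K) (hr : Z.rank ≤ r) :
    ∃ Z₀ ∈ K, Z₀.rank ≤ r ∧ ∀ Z' ∈ K, Z'.rank ≤ r → ‖H - Z₀‖ ≤ ‖H - Z'‖ := by
  obtain ⟨Z₀, hZ₀, hd⟩ := (hK.inter (isClosed_setOf_rank_le n₁ n₂ r)).exists_infDist_eq_dist
    ⟨Z, hZ, hr⟩ H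
  refine ⟨Z₀, hZ₀.1, hZ₀.2, fun Z' h1 h2 => ?_⟩
  rw [← dist_eq_norm, ← dist_eq_norm, ← hd]
  exact Metric.infDist_le_dist_of_mem ⟨h1, h2⟩

theorem isClosed_setOf_normal {n₁ n₂ : ℕ} (X δ : Mat n₁ n₂) :
    IsClosed {Z : Mat n₁ n₂ | ∀ W ∈ tangentSpace X, frobInner (Z - X - δ) W = 0} := by
  simp only [Set.ofPred_forall]
  refine isClosed_iInter fun W => isClosed_iInter fun _ => isClosed_eq ?_ continuous_const
  unfold frobInner
  fun_prop

/-! ### Existence of hard thresholdings -/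

theorem exists_isPercentile {n : ℕ} {γ : ℝ} (hγ₀ : 0 ≤ γ) (hγ₁ : γ ≤ 1) (v : Fin n → ℝ) :
    ∃ t, IsPercentile γ v t := by
  rcases isEmpty_or_nonempty (Fin n) with hn | hn
  · have : n = 0 := by
      rcases Nat.eq_zero_or_pos n with h | h
      · exact h
      · exact (hn.false ⟨0, h⟩).elim
    subst this
    exact ⟨0, by simp, by simp⟩
  -- The threshold is the largest entry that at least `γ n` entries reach. The next larger value, if
  -- any, is reached by fewer than `γ n`, which bounds the number of entries above the threshold.
  set J : Finset (Fin n) := Finset.univ.filter fun j =>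
    γ * n ≤ ((Finset.univ.filter fun i => |v j| ≤ |v i|).card : ℝ) with hJ
  have hJne : J.Nonempty := by
    obtain ⟨j, -, hj⟩ := Finset.exists_min_image Finset.univ (fun j => |v j|) Finset.univ_nonempty
    refine ⟨j, ?_⟩
    rw [hJ, Finset.mem_filter]
    refine ⟨Finset.mem_univ _, ?_⟩
    rw [Finset.filter_true_of_mem (fun i hi => hj i hi), Finset.card_univ, Fintype.card_fin]
    exact mul_le_of_le_one_left (Nat.cast_nonneg _) hγ₁
  obtain ⟨j, hjJ, hj⟩ := Finset.exists_max_image J (fun j => |v j|) hJne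
  refine ⟨|v j|, ?_, (Finset.mem_filter.1 hjJ).2⟩
  rcases (Finset.univ.filter fun i => |v j| < |v i|).eq_empty_or_nonempty with h0 | h0
  · rw [h0]
    simpa using mul_nonneg hγ₀ (Nat.cast_nonneg n)
  obtain ⟨i, hi, hmin⟩ := Finset.exists_min_image _ (fun j => |v j|) h0
  have hiJ : i ∉ J := fun h => absurd (hj i h) (not_le.2 (Finset.mem_filter.1 hi).2)
  rw [hJ, Finset.mem_filter, not_and, not_le] at hiJ
  refine le_trans ?_ (hiJ (Finset.mem_univ _)).le
  exact_mod_cast Finset.card_le_card fun k hk =>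
    Finset.mem_filter.2 ⟨Finset.mem_univ _, hmin k hk⟩

theorem exists_isTopFraction {n : ℕ} {γ : ℝ} (hγ₀ : 0 ≤ γ) (hγ₁ : γ ≤ 1) (v : Fin n → ℝ) :
    ∃ T, IsTopFraction γ v T := by
  obtain ⟨t, ht⟩ := exists_isPercentile hγ₀ hγ₁ v
  exact ⟨Finset.univ.filter fun j => t < |v j|, ht.1, t, ht, fun j hj => by simpa using hj,
    fun j hj => (Finset.mem_filter.1 hj).2.le⟩

theorem exists_isHardThreshold {n₁ n₂ : ℕ} {γ : ℝ} (hγ₀ : 0 ≤ γ) (hγ₁ : γ ≤ 1) (A : Mat n₁ n₂) :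
    ∃ G, IsHardThreshold γ A G := by
  choose T hT using fun i => exists_isTopFraction hγ₀ hγ₁ (fun j => A i j)
  choose T' hT' using fun j => exists_isTopFraction hγ₀ hγ₁ (fun i => A i j)
  exact ⟨fun i j => if j ∈ T i ∧ i ∈ T' j then 0 else A i j, T, T', hT, hT', fun _ _ => rfl⟩

/-! ### The error of hard thresholding -/

/-- An entry of `d - s`, with `s` sparse, that is not among the largest is controlled by `d`. -/
theorem sq_le_of_notMem_isTopFraction {n : ℕ} {γ γs : ℝ} {d s : Fin n → ℝ}
    (hs : ((Finset.univ.filter fun j => s j ≠ 0).card : ℝ) ≤ γs * n) {T : Finset (Fin n)}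
    (hT : IsTopFraction γ (fun j => d j - s j) T) {j : Fin n} (hj : j ∉ T) :
    (γ - γs) * n * (d j - s j) ^ 2 ≤ ∑ k, d k ^ 2 := by
  obtain ⟨-, t, ⟨-, ht⟩, hgt, -⟩ := hT
  have hjt : |d j - s j| ≤ t := not_lt.1 fun h => hj (hgt j h)
  set B := Finset.univ.filter fun k => t ≤ |d k - s k| with hB
  set S := Finset.univ.filter fun k => s k ≠ 0 with hS
  -- At least `γ n` entries reach `t` and at most `γs n` of them are corrupted. At the others `d`
  -- itself has absolute value at least `t ≥ |d j - s j|`.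
  have hcard : (γ - γs) * n ≤ ((B \ S).card : ℝ) := by
    have h1 : B.card ≤ (B \ S).card + S.card := by
      have := Finset.card_le_card_sdiff_add_card (s := B) (t := S)
      omega
    have h2 : (B.card : ℝ) ≤ (B \ S).card + S.card := by exact_mod_cast h1
    linarith
  calc (γ - γs) * n * (d j - s j) ^ 2 ≤ ((B \ S).card : ℝ) * (d j - s j) ^ 2 := by gcongr
    _ = ∑ k ∈ B \ S, (d j - s j) ^ 2 := by rw [Finset.sum_const, nsmul_eq_mul]
    _ ≤ ∑ k ∈ B \ S, d k ^ 2 := by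
      refine Finset.sum_le_sum fun k hk => ?_
      rw [Finset.mem_sdiff, hB, hS, Finset.mem_filter, Finset.mem_filter] at hk
      have hk0 : s k = 0 := by
        by_contra h
        exact hk.2 ⟨Finset.mem_univ _, h⟩
      have hkt := hk.1.2
      rw [hk0, sub_zero] at hkt
      exact sq_le_sq.2 (hjt.trans hkt)
    _ ≤ ∑ k, d k ^ 2 :=
      Finset.sum_le_sum_of_subset_of_nonneg (Finset.subset_univ _) fun _ _ _ => sq_nonneg _

/-- The test vector is the normalized `i`-th row of `U`. -/
theorem sum_sq_row_le {n r : ℕ} {U : Mat n r} {c : ℝ} (h : TwoInftyNormLE U c)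
    (i : Fin n) : ∑ k, U i k ^ 2 ≤ c ^ 2 := by
  set q := ∑ k, U i k ^ 2 with hq
  have hq0 : 0 ≤ q := Finset.sum_nonneg fun _ _ => sq_nonneg _
  rcases hq0.eq_or_lt with h0 | h0
  · rw [← h0]; positivity
  have hs : 0 < √q := Real.sqrt_pos.2 h0
  have hss : √q * √q = q := Real.mul_self_sqrt hq0
  have hnorm : ‖(WithLp.toLp 2 fun k => (√q)⁻¹ * U i k : EuclideanSpace ℝ (Fin r))‖ = 1 := by
    rw [EuclideanSpace.norm_eq]
    simp only [Real.norm_eq_abs, sq_abs, mul_pow, ← Finset.mul_sum]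
    rw [← hq, inv_pow, Real.sq_sqrt hq0, inv_mul_cancel₀ h0.ne', Real.sqrt_one]
  have h1 := h _ hnorm i
  have h2 : (U *ᵥ fun k => (√q)⁻¹ * U i k) i = √q := by
    have : (U *ᵥ fun k => (√q)⁻¹ * U i k) i = (√q)⁻¹ * q := by
      simp only [mulVec, dotProduct, hq, Finset.mul_sum]
      exact Finset.sum_congr rfl fun k _ => by ring
    rw [this]
    field_simp
    rw [sq, hss]
  rw [h2, abs_of_pos hs] at h1
  calc q = √q ^ 2 := (Real.sq_sqrt hq0).symm
    _ ≤ c ^ 2 := by gcongr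

theorem sum_sq_eq_of_orthonormal {n r : ℕ} {U : Mat n r} (hU : Uᵀ * U = 1) :
    ∑ i, ∑ k, U i k ^ 2 = r := by
  rw [← norm_sq_eq_sum, ← frobInner_self, frobInner_eq_trace, hU, trace_one, Fintype.card_fin]

/-- The coherence `μ` is at least `1`, and `μ r / n` bounds the squared row norms. -/
theorem one_le_and_sum_sq_row_le {n r : ℕ} (hr : 1 ≤ r) {U : Mat n r} (hU : Uᵀ * U = 1) {μ : ℝ}
    (h : TwoInftyNormLE U √(μ * r / n)) :
    1 ≤ μ ∧ 0 < n ∧ ∀ i, ∑ k, U i k ^ 2 ≤ μ * r / n := by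
  have hr' : (0 : ℝ) < r := by exact_mod_cast hr
  have hrow := sum_sq_row_le h
  have hsum : (r : ℝ) ≤ n * √(μ * r / n) ^ 2 := by
    calc (r : ℝ) = ∑ i, ∑ k, U i k ^ 2 := (sum_sq_eq_of_orthonormal hU).symm
      _ ≤ ∑ _i : Fin n, √(μ * r / n) ^ 2 := Finset.sum_le_sum fun i _ => hrow i
      _ = _ := by rw [Finset.sum_const, Finset.card_univ, Fintype.card_fin, nsmul_eq_mul]
  have hn : 0 < n := by
    rcases Nat.eq_zero_or_pos n with h0 | h0
    · subst h0; simp at hsum; linarith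
    · exact h0
  have hn' : (0 : ℝ) < n := by exact_mod_cast hn
  -- `Real.sqrt` is zero on negative numbers, so the sign of `μ` has to be extracted from `r ≤ n √(μ
  -- r / n)²`.
  have hpos : 0 < √(μ * r / n) := by
    rcases (Real.sqrt_nonneg (μ * r / n)).eq_or_lt with h0 | h0
    · rw [← h0] at hsum; simp at hsum; linarith
    · exact h0
  have hsq := Real.sq_sqrt (Real.sqrt_pos.1 hpos).le
  rw [hsq] at hsum hrow
  refine ⟨?_, hn, hrow⟩
  rw [mul_div_cancel₀ _ hn'.ne'] at hsum
  by_contra hc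
  push Not at hc
  nlinarith

/-- By Cauchy–Schwarz each squared entry of `U * B` is at most `c / n₁` times the squared norm of
its column of `B`; a column of weights sums to at most `κ n₁`. -/
theorem sum_weight_mul_sq_mul_le {n₁ n₂ r : ℕ} {κ c : ℝ} {w : Fin n₁ → Fin n₂ → ℝ}
    (hw : ∀ i j, 0 ≤ w i j) (hcol : ∀ j, ∑ i, w i j ≤ κ * n₁) (hn : 0 < n₁) (hc : 0 ≤ c)
    {U : Mat n₁ r} (hU : ∀ i, ∑ k, U i k ^ 2 ≤ c / n₁) (B : Mat r n₂) :
    ∑ i, ∑ j, w i j * (U * B) i j ^ 2 ≤ κ * c * ‖B‖ ^ 2 := by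
  have hn' : (0 : ℝ) < n₁ := by exact_mod_cast hn
  have hB : ‖B‖ ^ 2 = ∑ j, ∑ k, B k j ^ 2 := by rw [norm_sq_eq_sum, Finset.sum_comm]
  rw [Finset.sum_comm, hB, Finset.mul_sum]
  refine Finset.sum_le_sum fun j _ => ?_
  set b := ∑ k, B k j ^ 2
  have hb : 0 ≤ b := Finset.sum_nonneg fun _ _ => sq_nonneg _
  calc ∑ i, w i j * (U * B) i j ^ 2 ≤ ∑ i, w i j * (c / n₁ * b) := by
        refine Finset.sum_le_sum fun i _ => mul_le_mul_of_nonneg_left ?_ (hw i j)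
        rw [mul_apply]
        exact (Finset.sum_mul_sq_le_sq_mul_sq _ _ _).trans (mul_le_mul_of_nonneg_right (hU i) hb)
    _ = (∑ i, w i j) * (c / n₁ * b) := by rw [Finset.sum_mul]
    _ ≤ κ * n₁ * (c / n₁ * b) := by
        apply mul_le_mul_of_nonneg_right (hcol j)
        positivity
    _ = κ * c * b := by field_simp

theorem sum_weight_mul_sq_mul_transpose_le {n₁ n₂ r : ℕ} {κ c : ℝ} {w : Fin n₁ → Fin n₂ → ℝ}
    (hw : ∀ i j, 0 ≤ w i j) (hrow : ∀ i, ∑ j, w i j ≤ κ * n₂) (hn : 0 < n₂) (hc : 0 ≤ c)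
    {V : Mat n₂ r} (hV : ∀ j, ∑ k, V j k ^ 2 ≤ c / n₂) (B : Mat n₁ r) :
    ∑ i, ∑ j, w i j * (B * Vᵀ) i j ^ 2 ≤ κ * c * ‖B‖ ^ 2 := by
  have h := sum_weight_mul_sq_mul_le (w := fun j i => w i j) (fun j i => hw i j) hrow hn hc hV Bᵀ
  rw [Finset.sum_comm, frobenius_norm_transpose] at h
  have he : ∀ i j, (V * Bᵀ) j i = (B * Vᵀ) i j := fun i j => by
    rw [← transpose_apply (V * Bᵀ), transpose_mul, transpose_transpose]
  simpa only [he] using h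

/-- A weighted sum of squared entries over a sparse set of positions is small, up to the component
normal to the tangent space of incoherent matrices. -/
theorem sum_weight_mul_sq_le {n₁ n₂ r : ℕ} {κ c : ℝ} {w : Fin n₁ → Fin n₂ → ℝ}
    (hw : ∀ i j, 0 ≤ w i j) (hw2 : ∀ i j, w i j ≤ 2) (hrow : ∀ i, ∑ j, w i j ≤ κ * n₂)
    (hcol : ∀ j, ∑ i, w i j ≤ κ * n₁) (hn₁ : 0 < n₁) (hn₂ : 0 < n₂) (hκ : 0 ≤ κ) (hc : 0 ≤ c)
    {U : Mat n₁ r} {V : Mat n₂ r} (hUo : Uᵀ * U = 1) (hVo : Vᵀ * V = 1)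
    (hU : ∀ i, ∑ k, U i k ^ 2 ≤ c / n₁) (hV : ∀ j, ∑ k, V j k ^ 2 ≤ c / n₂) (D : Mat n₁ n₂) :
    ∑ i, ∑ j, w i j * D i j ^ 2 ≤
      4 * κ * c * ‖D‖ ^ 2 + 4 * ‖(1 - U * Uᵀ) * D * (1 - V * Vᵀ)‖ ^ 2 := by
  set E := (1 - U * Uᵀ) * D * (1 - V * Vᵀ) with hE
  set A := U * (Uᵀ * D) with hA
  set B := (1 - U * Uᵀ) * D * V * Vᵀ with hB
  have hD : D = A + B + E := by
    rw [hA, hB, hE]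
    simp only [Matrix.mul_sub, Matrix.sub_mul, Matrix.mul_one, Matrix.one_mul, Matrix.mul_assoc]
    abel
  have h1 := sum_weight_mul_sq_mul_le hw hcol hn₁ hc hU (Uᵀ * D)
  have h2 := sum_weight_mul_sq_mul_transpose_le hw hrow hn₂ hc hV ((1 - U * Uᵀ) * D * V)
  rw [← hA] at h1
  rw [← hB] at h2
  have hsplit : ‖D‖ ^ 2 = ‖Uᵀ * D‖ ^ 2 + (‖(1 - U * Uᵀ) * D * V‖ ^ 2 + ‖E‖ ^ 2) := by
    rw [norm_sq_split_left hUo, norm_sq_split_right hVo ((1 - U * Uᵀ) * D)]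
  have hpt : ∀ i j, w i j * D i j ^ 2 ≤
      4 * (w i j * A i j ^ 2) + 4 * (w i j * B i j ^ 2) + 4 * E i j ^ 2 := by
    intro i j
    have hDij : D i j = A i j + B i j + E i j := by
      conv_lhs => rw [hD]
      rfl
    rw [hDij]
    have hq : (A i j + B i j + E i j) ^ 2 ≤ 4 * A i j ^ 2 + 4 * B i j ^ 2 + 2 * E i j ^ 2 := by
      nlinarith [sq_nonneg (A i j + B i j - E i j), sq_nonneg (A i j - B i j)]
    have := mul_le_mul_of_nonneg_left hq (hw i j)
    nlinarith [mul_le_mul_of_nonneg_right (hw2 i j) (sq_nonneg (E i j))]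
  have hsum : ∑ i, ∑ j, w i j * D i j ^ 2 ≤ 4 * (∑ i, ∑ j, w i j * A i j ^ 2) +
      4 * (∑ i, ∑ j, w i j * B i j ^ 2) + 4 * ‖E‖ ^ 2 := by
    rw [norm_sq_eq_sum]
    simp only [Finset.mul_sum, ← Finset.sum_add_distrib]
    exact Finset.sum_le_sum fun i _ => Finset.sum_le_sum fun j _ => hpt i j
  have hκc : 0 ≤ κ * c := mul_nonneg hκ hc
  nlinarith [mul_nonneg hκc (sq_nonneg ‖E‖)]

/-- Hard thresholding of `D - S`, with `S` sparse, recovers `D` up to a small relative error. -/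
theorem norm_hardThreshold_sub_sq_le {n₁ n₂ r : ℕ} {γ γs c : ℝ} (hγs : 0 ≤ γs) (hγ : γs < γ)
    {D S G : Mat n₁ n₂} (hS : IsSparse γs S) (hG : IsHardThreshold γ (D - S) G)
    (hn₁ : 0 < n₁) (hn₂ : 0 < n₂) (hc : 0 ≤ c)
    {U : Mat n₁ r} {V : Mat n₂ r} (hUo : Uᵀ * U = 1) (hVo : Vᵀ * V = 1)
    (hU : ∀ i, ∑ k, U i k ^ 2 ≤ c / n₁) (hV : ∀ j, ∑ k, V j k ^ 2 ≤ c / n₂) :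
    ‖G - D‖ ^ 2 ≤ (4 * (γ + 2 * γs) * c + 4 * (γs / (γ - γs))) * ‖D‖ ^ 2 +
      4 * ‖(1 - U * Uᵀ) * D * (1 - V * Vᵀ)‖ ^ 2 := by
  obtain ⟨T, T', hT, hT', hG⟩ := hG
  have hn₁' : (0 : ℝ) < n₁ := by exact_mod_cast hn₁
  have hn₂' : (0 : ℝ) < n₂ := by exact_mod_cast hn₂
  have hgap : 0 < γ - γs := sub_pos.2 hγ
  let u : Fin n₁ → Fin n₂ → ℝ := fun i j => if S i j ≠ 0 then 1 else 0
  -- The coefficient with which the entry of `D` is charged: once where removed, twice where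
  -- corrupted and kept, never elsewhere.
  let w : Fin n₁ → Fin n₂ → ℝ := fun i j => if j ∈ T i ∧ i ∈ T' j then 1 else 2 * u i j
  have hu0 : ∀ i j, 0 ≤ u i j := fun i j => by simp only [u]; split_ifs <;> norm_num
  have hu1 : ∀ i j, u i j ≤ 1 := fun i j => by simp only [u]; split_ifs <;> norm_num
  have hurow : ∀ i, ∑ j, u i j ≤ γs * n₂ := fun i => by
    simp only [u, Finset.sum_boole]; exact hS.1 i
  have hucol : ∀ j, ∑ i, u i j ≤ γs * n₁ := fun j => by
    simp only [u, Finset.sum_boole]; exact hS.2 j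
  have hw0 : ∀ i j, 0 ≤ w i j := fun i j => by
    simp only [w]; split_ifs
    · norm_num
    · linarith [hu0 i j]
  have hw2 : ∀ i j, w i j ≤ 2 := fun i j => by
    simp only [w]; split_ifs
    · norm_num
    · linarith [hu1 i j]
  have hwrow : ∀ i, ∑ j, w i j ≤ (γ + 2 * γs) * n₂ := fun i => by
    calc ∑ j, w i j ≤ ∑ j, ((if j ∈ T i then 1 else 0) + 2 * u i j) := by
          refine Finset.sum_le_sum fun j _ => ?_
          have := hu0 i j
          simp only [w]; split_ifs <;> first | linarith | (exfalso; tauto)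
      _ = (T i).card + 2 * ∑ j, u i j := by
          rw [Finset.sum_add_distrib, Finset.sum_boole, Finset.mul_sum]; simp
      _ ≤ _ := by linarith [(hT i).1, hurow i]
  have hwcol : ∀ j, ∑ i, w i j ≤ (γ + 2 * γs) * n₁ := fun j => by
    calc ∑ i, w i j ≤ ∑ i, ((if i ∈ T' j then 1 else 0) + 2 * u i j) := by
          refine Finset.sum_le_sum fun i _ => ?_
          have := hu0 i j
          simp only [w]; split_ifs <;> first | linarith | (exfalso; tauto)
      _ = (T' j).card + 2 * ∑ i, u i j := by
          rw [Finset.sum_add_distrib, Finset.sum_boole, Finset.mul_sum]; simp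
      _ ≤ _ := by linarith [(hT' j).1, hucol j]
  have hmain := sum_weight_mul_sq_le hw0 hw2 hwrow hwcol hn₁ hn₂ (by linarith) hc hUo hVo hU hV D
  set ρ : Fin n₁ → ℝ := fun i => ∑ j, D i j ^ 2 with hρ
  set κ : Fin n₂ → ℝ := fun j => ∑ i, D i j ^ 2 with hκ
  have hρ0 : ∀ i, 0 ≤ ρ i := fun i => Finset.sum_nonneg fun _ _ => sq_nonneg _
  have hκ0 : ∀ j, 0 ≤ κ j := fun j => Finset.sum_nonneg fun _ _ => sq_nonneg _
  have hρsum : ∑ i, ρ i = ‖D‖ ^ 2 := (norm_sq_eq_sum D).symm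
  have hκsum : ∑ j, κ j = ‖D‖ ^ 2 := by rw [norm_sq_eq_sum, Finset.sum_comm]
  have hsmall : ∀ i j, ¬(j ∈ T i ∧ i ∈ T' j) →
      (D i j - S i j) ^ 2 ≤ ρ i / ((γ - γs) * n₂) + κ j / ((γ - γs) * n₁) := by
    intro i j hij
    have hp : 0 ≤ ρ i / ((γ - γs) * n₂) := div_nonneg (hρ0 i) (by positivity)
    have hq : 0 ≤ κ j / ((γ - γs) * n₁) := div_nonneg (hκ0 j) (by positivity)
    by_cases hj : j ∈ T i
    · have h := sq_le_of_notMem_isTopFraction (d := fun i => D i j) (s := fun i => S i j)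
        (hS.2 j) (hT' j) (fun h => hij ⟨hj, h⟩)
      have : (D i j - S i j) ^ 2 ≤ κ j / ((γ - γs) * n₁) := by
        rw [le_div_iff₀ (by positivity)]; linarith
      linarith
    · have h := sq_le_of_notMem_isTopFraction (d := fun j => D i j) (s := fun j => S i j)
        (hS.1 i) (hT i) hj
      have : (D i j - S i j) ^ 2 ≤ ρ i / ((γ - γs) * n₂) := by
        rw [le_div_iff₀ (by positivity)]; linarith
      linarith
  have hpt : ∀ i j, (G - D) i j ^ 2 ≤ w i j * D i j ^ 2 +
      (2 * (u i j * (ρ i / ((γ - γs) * n₂))) + 2 * (u i j * (κ j / ((γ - γs) * n₁)))) := by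
    intro i j
    have hp : 0 ≤ ρ i / ((γ - γs) * n₂) := div_nonneg (hρ0 i) (by positivity)
    have hq : 0 ≤ κ j / ((γ - γs) * n₁) := div_nonneg (hκ0 j) (by positivity)
    rw [Matrix.sub_apply, hG]
    by_cases hij : j ∈ T i ∧ i ∈ T' j
    · simp only [w, if_pos hij]
      nlinarith [mul_nonneg (hu0 i j) hp, mul_nonneg (hu0 i j) hq]
    · simp only [w, if_neg hij]
      rw [Matrix.sub_apply]
      by_cases hs : S i j = 0
      · simp [u, hs]
      · have hu : u i j = 1 := by simp [u, hs]
        rw [hu]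
        -- At a corrupted position that is kept the error is `-S = (D - S) - D`, so its square is at
        -- most `2 (D - S)² + 2 D²`.
        nlinarith [hsmall i j hij, sq_nonneg (D i j - S i j + D i j)]
  have hrowsum : ∑ i, ∑ j, u i j * (ρ i / ((γ - γs) * n₂)) ≤ γs / (γ - γs) * ‖D‖ ^ 2 := by
    rw [← hρsum, Finset.mul_sum]
    refine Finset.sum_le_sum fun i _ => ?_
    rw [← Finset.sum_mul]
    calc _ ≤ γs * n₂ * (ρ i / ((γ - γs) * n₂)) :=
          mul_le_mul_of_nonneg_right (hurow i) (div_nonneg (hρ0 i) (by positivity))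
      _ = _ := by field_simp
  have hcolsum : ∑ i, ∑ j, u i j * (κ j / ((γ - γs) * n₁)) ≤ γs / (γ - γs) * ‖D‖ ^ 2 := by
    rw [← hκsum, Finset.mul_sum, Finset.sum_comm]
    refine Finset.sum_le_sum fun j _ => ?_
    rw [← Finset.sum_mul]
    calc _ ≤ γs * n₁ * (κ j / ((γ - γs) * n₁)) :=
          mul_le_mul_of_nonneg_right (hucol j) (div_nonneg (hκ0 j) (by positivity))
      _ = _ := by field_simp
  have htotal : ‖G - D‖ ^ 2 ≤ ∑ i, ∑ j, w i j * D i j ^ 2 +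
      (2 * (∑ i, ∑ j, u i j * (ρ i / ((γ - γs) * n₂))) +
        2 * ∑ i, ∑ j, u i j * (κ j / ((γ - γs) * n₁))) := by
    rw [norm_sq_eq_sum]
    simp only [Finset.mul_sum, ← Finset.sum_add_distrib]
    exact Finset.sum_le_sum fun i _ => Finset.sum_le_sum fun j _ => hpt i j
  linarith

/-! ### One step of gradient descent -/

theorem norm_le_of_isTangentProjection {n₁ n₂ : ℕ} {X G P : Mat n₁ n₂}
    (h : IsTangentProjection X G P) : ‖P‖ ≤ ‖G‖ := by
  have h1 := h.2 P h.1
  rw [frobInner_sub_left, frobInner_self] at h1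
  have h2 := (le_abs_self _).trans (abs_frobInner_le G P)
  by_contra hc
  push Not at hc
  nlinarith [norm_nonneg G]

theorem smul_mem_tangentSpace {n₁ n₂ : ℕ} {X W : Mat n₁ n₂} (c : ℝ) (h : W ∈ tangentSpace X) :
    c • W ∈ tangentSpace X := by
  obtain ⟨A, B, rfl⟩ := h
  exact ⟨c • A, c • B, by rw [smul_add, Matrix.smul_mul, Matrix.mul_smul]⟩

/-- The Riemannian gradient has a definite component along the error. -/
theorem le_frobInner_of_isTangentProjection {n₁ n₂ r : ℕ} {σ C : ℝ} {X Ls G P : Mat n₁ n₂}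
    {U : Mat n₁ r} {M : Mat r r} {V : Mat n₂ r} (h : IsCompactFactorization σ X U M V)
    (hLs : Ls.rank = r) (hd : ‖X - Ls‖ < σ) (hC : C < 1 / 2)
    (hG : ‖G - (X - Ls)‖ ≤ C * ‖X - Ls‖) (hP : IsTangentProjection X G P) :
    (1 - 2 * C) / 4 * ‖X - Ls‖ ^ 2 ≤ frobInner P (X - Ls) := by
  set D := X - Ls with hD
  have hσ : 0 < σ := (norm_nonneg _).trans_lt hd
  have hT := h.isTangentProjection hσ D
  set E := (1 - U * Uᵀ) * D * (1 - V * Vᵀ) with hE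
  set Q := D - E with hQ
  have hDE : D - Q = E := by rw [hQ, sub_sub_cancel]
  have hEorth : ∀ W ∈ tangentSpace X, frobInner E W = 0 := by
    intro W hW
    rw [← hDE]
    exact hT.2 W hW
  have hEbound : ‖E‖ ≤ ‖D‖ / 2 := by
    have h1 := h.norm_normal_le hLs (by rw [norm_sub_rev]; exact hd)
    have h2 : (1 - U * Uᵀ) * (Ls - X) * (1 - V * Vᵀ) = -E := by
      rw [hE, hD, ← neg_sub X Ls, Matrix.mul_neg, Matrix.neg_mul]
    rw [h2, norm_neg, norm_sub_rev, ← hD] at h1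
    have h3 : σ * (2 * ‖E‖) ≤ σ * ‖D‖ := by nlinarith [norm_nonneg D]
    linarith [le_of_mul_le_mul_left h3 hσ]
  have hpyth : ‖D‖ ^ 2 = ‖Q‖ ^ 2 + ‖E‖ ^ 2 := by
    have h1 : D = Q + E := by rw [hQ]; abel
    rw [h1, norm_add_sq_eq, frobInner_comm, hEorth Q hT.1]
    ring
  have hQlow : ‖D‖ / 2 ≤ ‖Q‖ := by
    apply le_of_sq_le_sq _ (norm_nonneg _)
    nlinarith [norm_nonneg E, norm_nonneg D]
  have h1 : frobInner P D = frobInner G Q := by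
    have e1 : frobInner P E = 0 := by rw [frobInner_comm]; exact hEorth P hP.1
    have e2 := hP.2 Q hT.1
    have e3 : frobInner P Q = frobInner P D - frobInner P E := by rw [hQ, frobInner_sub_right]
    rw [frobInner_sub_left] at e2
    linarith
  have h2 : frobInner G Q = frobInner (G - D) Q + ‖Q‖ ^ 2 := by
    have e1 := hEorth Q hT.1
    have e2 : frobInner D Q = frobInner Q Q + frobInner E Q := by
      rw [← frobInner_add_left, hQ, sub_add_cancel]
    rw [frobInner_self] at e2
    rw [frobInner_sub_left]
    linarith
  have h3 : -(C * ‖D‖ * ‖Q‖) ≤ frobInner (G - D) Q := by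
    have e1 := (abs_le.1 (abs_frobInner_le (G - D) Q)).1
    have e2 := mul_le_mul_of_nonneg_right hG (norm_nonneg Q)
    linarith
  rw [h1, h2]
  -- `‖Q‖ (‖Q‖ - C ‖D‖)` is at least its value at `‖Q‖ = ‖D‖ / 2`, because `C < 1 / 2`.
  nlinarith [norm_nonneg D, mul_nonneg (sub_nonneg.2 hQlow) (norm_nonneg D),
    mul_nonneg (sub_nonneg.2 hQlow) (norm_nonneg Q),
    mul_nonneg (mul_nonneg (sub_nonneg.2 hQlow) (norm_nonneg D)) (sub_nonneg.2 hC.le)]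

/-- A small Riemannian gradient step, followed by any map to a matrix that is at least as close as
the orthographic one, contracts the error. -/
theorem exists_admissible_and_norm_sub_le {n₁ n₂ r : ℕ} {σ C η : ℝ} {X Ls G P : Mat n₁ n₂}
    {U : Mat n₁ r} {M : Mat r r} {V : Mat n₂ r} (h : IsCompactFactorization σ Ls U M V)
    (hLs : Ls.rank = r) (hX : X.rank = r) (hd : 2 * ‖X - Ls‖ < σ) (hC₀ : 0 ≤ C) (hC : C < 1 / 2)
    (hη₀ : 0 < η) (hη : η ≤ (1 - 2 * C) / 40)
    (hG : ‖G - (X - Ls)‖ ≤ C * ‖X - Ls‖) (hP : IsTangentProjection X G P) :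
    ∃ Z₀, IsOrthographicAdmissible r X (-(η • P)) Z₀ ∧ ∀ Z : Mat n₁ n₂,
      ‖X + -(η • P) - Z‖ ≤ ‖X + -(η • P) - Z₀‖ →
        ‖Z - Ls‖ ≤ (1 - (1 - 2 * C) / 8 * η) * ‖X - Ls‖ := by
  have hd0 := norm_nonneg (X - Ls)
  obtain ⟨U', M', V', hX'⟩ := h.exists_of_rank_eq hX (by linarith)
  have hPD := le_frobInner_of_isTangentProjection hX' hLs (by linarith) hC hG hP
  have hPn : ‖P‖ ≤ 3 / 2 * ‖X - Ls‖ := by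
    have h1 := norm_le_of_isTangentProjection hP
    have h2 : ‖G‖ ≤ ‖G - (X - Ls)‖ + ‖X - Ls‖ := by
      simpa using norm_add_le (G - (X - Ls)) (X - Ls)
    nlinarith
  have hδmem : -(η • P) ∈ tangentSpace X := by
    rw [← neg_smul]; exact smul_mem_tangentSpace _ hP.1
  set δ := -(η • P) with hδ
  have hδn : ‖δ‖ = η * ‖P‖ := by
    rw [hδ, norm_neg, norm_smul, Real.norm_of_nonneg hη₀.le]
  set d := ‖X - Ls‖ with hdd
  have hη1 : η ≤ 1 / 40 := by linarith
  have hδle : ‖δ‖ ≤ 3 / 2 * η * d := by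
    rw [hδn]; nlinarith
  have hδσ : ‖δ‖ ≤ σ / 8 := by nlinarith
  obtain ⟨Z₀, hZ₀, hE⟩ := hX'.exists_isOrthographicAdmissible hδmem (by linarith)
  refine ⟨Z₀, hZ₀, fun Z hZ => ?_⟩
  have hσ : 0 < σ := by linarith
  have hEn : ‖X + δ - Z₀‖ ≤ 3 * η ^ 2 * d := by
    -- `3 / 8 = 1 - 1 / 2 - 1 / 8`: passing from `Ls` to `X` loses at most `σ / 2`, and the step `δ`
    -- at most `σ / 8`.
    have h1 : 3 / 8 * σ * ‖X + δ - Z₀‖ ≤ ‖δ‖ ^ 2 := by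
      refine le_trans ?_ hE
      gcongr
      linarith
    have h2 : ‖δ‖ ^ 2 ≤ (3 / 2 * η * d) ^ 2 := by gcongr
    have h3 : (3 / 2 * η * d) ^ 2 ≤ 3 / 8 * σ * (3 * η ^ 2 * d) := by
      have : 0 ≤ η ^ 2 * d * (σ - 2 * d) := by
        apply mul_nonneg (by positivity); linarith
      nlinarith
    exact le_of_mul_le_mul_left (h1.trans (h2.trans h3)) (by positivity)
  have hstep : ‖X + δ - Ls‖ ≤ (1 - (1 - 2 * C) / 4 * η + 9 / 8 * η ^ 2) * d := by
    have hfac : 0 ≤ 1 - (1 - 2 * C) / 4 * η + 9 / 8 * η ^ 2 := by nlinarith [sq_nonneg η]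
    apply le_of_sq_le_sq _ (by positivity)
    have e1 : X + δ - Ls = (X - Ls) + δ := by abel
    have e2 : frobInner (X - Ls) δ = -(η * frobInner P (X - Ls)) := by
      rw [hδ, ← neg_smul, frobInner_smul_right, frobInner_comm]; ring
    rw [e1, norm_add_sq_eq, e2, ← hdd]
    have h2 : ‖δ‖ ^ 2 ≤ (3 / 2 * η * d) ^ 2 := by gcongr
    have h3 := mul_le_mul_of_nonneg_left hPD hη₀.le
    -- The square root is taken through `1 + 2x ≤ (1 + x)²`.
    nlinarith [mul_nonneg (sq_nonneg (-(1 - 2 * C) / 4 * η + 9 / 8 * η ^ 2)) (sq_nonneg d)]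
  have htri : ‖Z - Ls‖ ≤ ‖X + δ - Ls‖ + ‖X + δ - Z‖ := by
    have e1 : Z - Ls = (X + δ - Ls) - (X + δ - Z) := by abel
    rw [e1]
    exact norm_sub_le _ _
  -- `33 / 8 = 9 / 8 + 3` collects the second-order terms of step and retraction; `40 ≥ 33` in the
  -- bound on `η` suffices.
  have hη2 : 33 / 8 * η ^ 2 ≤ (1 - 2 * C) / 8 * η := by
    have e1 := mul_le_mul_of_nonneg_right hη hη₀.le
    have e2 : 0 ≤ (1 - 2 * C) * η := mul_nonneg (by linarith) hη₀.le
    nlinarith only [e1, e2]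
  have hfin : 33 / 8 * η ^ 2 * d ≤ (1 - 2 * C) / 8 * η * d :=
    mul_le_mul_of_nonneg_right hη2 hd0
  linarith only [htri, hfin, hstep, hEn, hZ]

/-- The same `Z₀` is a competitor for both retractions: it has rank `r` and its residual is normal.
-/
theorem IsUpdate.norm_sub_le {n₁ n₂ r : ℕ} {σ C η : ℝ} {X Ls G X' : Mat n₁ n₂}
    {U : Mat n₁ r} {M : Mat r r} {V : Mat n₂ r} (h : IsCompactFactorization σ Ls U M V)
    (hLs : Ls.rank = r) (hX : X.rank = r) (hd : 2 * ‖X - Ls‖ < σ) (hC₀ : 0 ≤ C) (hC : C < 1 / 2)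
    (hη₀ : 0 < η) (hη : η ≤ (1 - 2 * C) / 40) (hG : ‖G - (X - Ls)‖ ≤ C * ‖X - Ls‖)
    {R : Mat n₁ n₂ → Mat n₁ n₂ → Mat n₁ n₂ → Prop}
    (hR : R = IsProjectiveRetraction r ∨ R = IsOrthographicRetraction r)
    (hX' : IsUpdate R η X G X') :
    X'.rank = r ∧ ‖X' - Ls‖ ≤ (1 - (1 - 2 * C) / 8 * η) * ‖X - Ls‖ := by
  obtain ⟨P, hP, hret⟩ := hX'
  obtain ⟨Z₀, hZ₀, hbound⟩ := exists_admissible_and_norm_sub_le h hLs hX hd hC₀ hC hη₀ hη hG hP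
  rcases hR with rfl | rfl
  · exact ⟨hret.1, hbound X' (hret.2 Z₀ hZ₀.1)⟩
  · exact ⟨hret.1.1, hbound X' (hret.2 Z₀ hZ₀)⟩

theorem exists_isUpdate {n₁ n₂ r : ℕ} {σ C η : ℝ} {X Ls G : Mat n₁ n₂}
    {U : Mat n₁ r} {M : Mat r r} {V : Mat n₂ r} (h : IsCompactFactorization σ Ls U M V)
    (hLs : Ls.rank = r) (hX : X.rank = r) (hd : 2 * ‖X - Ls‖ < σ) (hC₀ : 0 ≤ C) (hC : C < 1 / 2)
    (hη₀ : 0 < η) (hη : η ≤ (1 - 2 * C) / 40) (hG : ‖G - (X - Ls)‖ ≤ C * ‖X - Ls‖)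
    {R : Mat n₁ n₂ → Mat n₁ n₂ → Mat n₁ n₂ → Prop}
    (hR : R = IsProjectiveRetraction r ∨ R = IsOrthographicRetraction r) :
    ∃ X', IsUpdate R η X G X' := by
  have hd0 := norm_nonneg (X - Ls)
  obtain ⟨U', M', V', hX'⟩ := h.exists_of_rank_eq hX (by linarith)
  have hP := hX'.isTangentProjection (by linarith) G
  obtain ⟨Z₀, hZ₀, hbound⟩ := exists_admissible_and_norm_sub_le h hLs hX hd hC₀ hC hη₀ hη hG hP
  generalize G - (1 - U' * U'ᵀ) * G * (1 - V' * V'ᵀ) = P at *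
  -- A minimizer over rank at most `r` is no farther from the stepped point than `Z₀`, so it stays
  -- within `σ` of `Ls` and its rank cannot fall below `r`.
  have hrank : ∀ Z : Mat n₁ n₂, Z.rank ≤ r → ‖X + -(η • P) - Z‖ ≤ ‖X + -(η • P) - Z₀‖ →
      Z.rank = r := fun Z hZ hle => by
    refine le_antisymm hZ (h.le_rank ?_)
    have h1 := hbound Z hle
    have h2 : (1 - (1 - 2 * C) / 8 * η) * ‖X - Ls‖ ≤ 1 * ‖X - Ls‖ := by
      gcongr
      nlinarith
    linarith
  rcases hR with rfl | rfl
  · obtain ⟨Z, -, hZr, hmin⟩ := exists_nearest_of_isClosed (H := X + -(η • P)) isClosed_univ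
      (Set.mem_univ Z₀) hZ₀.1.le
    exact ⟨Z, P, hP, hrank Z hZr (hmin Z₀ (Set.mem_univ _) hZ₀.1.le),
      fun Z' hZ' => hmin Z' (Set.mem_univ _) hZ'.le⟩
  · obtain ⟨Z, hZK, hZr, hmin⟩ := exists_nearest_of_isClosed (H := X + -(η • P))
      (isClosed_setOf_normal X (-(η • P))) hZ₀.2 hZ₀.1.le
    exact ⟨Z, P, hP, ⟨hrank Z hZr (hmin Z₀ hZ₀.2 hZ₀.1.le), hZK⟩,
      fun Z' hZ' => hmin Z' hZ'.2 hZ'.1.le⟩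

end RobustPCA

/-! ### Linear convergence by induction on the iterates -/

theorem theorem1 {n₁ n₂ r : ℕ} (hr : 1 ≤ r)
    (Y Ls Ss L₀ : RobustPCA.Mat n₁ n₂) (hY : Y = Ls + Ss)
    (γs γ μ a C₁ : ℝ) (hγs₀ : 0 ≤ γs) (hγs₁ : γs < 1)
    (hS : RobustPCA.IsSparse γs Ss)
    (hrank : Ls.rank = r) (hL : RobustPCA.IsIncoherent μ r Ls)
    (hL₀ : L₀.rank = r) (hinit : ‖L₀ - Ls‖ ≤ a * RobustPCA.singularValue r Ls)
    (ha : a ≤ 1 / 2) (hγ : 2 * γs < γ)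
    (hC₁ : C₁ = Real.sqrt (4 * (γ + 2 * γs) * μ * r + 4 * (γs / (γ - γs)) + a ^ 2))
    (hC₁_lt : C₁ < 1 / 2) :
    ∃ η₀ : ℝ, 0 < η₀ ∧ ∀ η : ℝ, 0 < η → η < η₀ →
      ∀ R : RobustPCA.Mat n₁ n₂ → RobustPCA.Mat n₁ n₂ → RobustPCA.Mat n₁ n₂ → Prop,
        R = RobustPCA.IsProjectiveRetraction r ∨ R = RobustPCA.IsOrthographicRetraction r →
        ∀ L : ℕ → RobustPCA.Mat n₁ n₂, L 0 = L₀ →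
          ∀ k : ℕ, (∀ i < k, RobustPCA.IsStep R γ η Y (L i) (L (i + 1))) →
            ‖L k - Ls‖ ≤ (1 - (1 - 2 * C₁) / 8 * η) ^ k * ‖L₀ - Ls‖ ∧
              RobustPCA.CanContinue R γ η Y (L k) := by
  obtain ⟨U, s, V, hsvd, hUinc, hVinc⟩ := hL
  have hF := hsvd.isCompactFactorization hr hrank
  have hσ := RobustPCA.singularValue_pos hr hrank
  set σ := RobustPCA.singularValue r Ls
  obtain ⟨hμ, hn₁, hU⟩ := RobustPCA.one_le_and_sum_sq_row_le hr hsvd.left_orthonormal hUinc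
  obtain ⟨-, hn₂, hV⟩ := RobustPCA.one_le_and_sum_sq_row_le hr hsvd.right_orthonormal hVinc
  have hr' : (1 : ℝ) ≤ r := by exact_mod_cast hr
  have hμr : 1 ≤ μ * r := one_le_mul_of_one_le_of_one_le hμ hr'
  have hfrac : 0 ≤ γs / (γ - γs) := div_nonneg hγs₀ (by linarith)
  -- Since `μ r ≥ 1`, smallness of `C₁` forces `γ ≤ 1`, without which a top `γ`-fraction need not
  -- exist.
  have hγμ : γ ≤ (γ + 2 * γs) * μ * r := by
    have : γ * 1 ≤ (γ + 2 * γs) * (μ * r) := by gcongr <;> linarith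
    linarith
  have hC₀ : 0 ≤ C₁ := hC₁ ▸ Real.sqrt_nonneg _
  have hCsq : C₁ ^ 2 = 4 * (γ + 2 * γs) * μ * r + 4 * (γs / (γ - γs)) + a ^ 2 := by
    rw [hC₁, Real.sq_sqrt]
    linarith [sq_nonneg a]
  have hCsq_lt : C₁ ^ 2 < 1 / 4 := by nlinarith only [hC₀, hC₁_lt]
  have hγ₁ : γ ≤ 1 := by linarith [sq_nonneg a]
  have ha_lt : |a| < 1 / 2 := abs_lt_of_sq_lt_sq (by linarith) (by norm_num)
  have hinit' : ‖L₀ - Ls‖ ≤ |a| * σ :=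
    hinit.trans (mul_le_mul_of_nonneg_right (le_abs_self a) hσ.le)
  have hnear : ∀ X : RobustPCA.Mat n₁ n₂, ‖X - Ls‖ ≤ |a| * σ → 2 * ‖X - Ls‖ < σ := by
    intro X hd
    have := mul_lt_mul_of_pos_right ha_lt hσ
    linarith
  have hgrad : ∀ X G : RobustPCA.Mat n₁ n₂, X.rank = r → ‖X - Ls‖ ≤ |a| * σ →
      RobustPCA.IsHardThreshold γ (X - Y) G → ‖G - (X - Ls)‖ ≤ C₁ * ‖X - Ls‖ := by
    intro X G hX hd hG
    have hXY : X - Y = X - Ls - Ss := by rw [hY, sub_sub]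
    rw [hXY] at hG
    have h1 := RobustPCA.norm_hardThreshold_sub_sq_le hγs₀ (by linarith) hS hG hn₁ hn₂
      (by linarith) hsvd.left_orthonormal hsvd.right_orthonormal hU hV
    have h2 := hF.norm_normal_le hX (by linarith [hnear X hd, norm_nonneg (X - Ls)])
    set E := (1 - U * U.transpose) * (X - Ls) * (1 - V * V.transpose)
    -- Curvature gives `2 σ ‖E‖ ≤ ‖X - Ls‖² ≤ |a| σ ‖X - Ls‖`. Squared, this is the `a²` in `C₁²`.
    have h3 : 2 * ‖E‖ ≤ |a| * ‖X - Ls‖ := by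
      refine le_of_mul_le_mul_left ?_ hσ
      have := mul_le_mul_of_nonneg_right hd (norm_nonneg (X - Ls))
      linarith only [this, h2]
    have h4 : (2 * ‖E‖) ^ 2 ≤ (|a| * ‖X - Ls‖) ^ 2 := by gcongr
    rw [mul_pow |a|, sq_abs] at h4
    apply le_of_sq_le_sq _ (by positivity)
    rw [mul_pow, hCsq]
    linarith only [h1, h4]
  refine ⟨(1 - 2 * C₁) / 40, by linarith, fun η hη₀ hη R hR L hL0 k hstep => ?_⟩
  have hq₀ : 0 ≤ 1 - (1 - 2 * C₁) / 8 * η := by nlinarith only [hη₀, hη, hC₀, hC₁_lt]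
  have hq₁ : 1 - (1 - 2 * C₁) / 8 * η ≤ 1 := by nlinarith only [hη₀, hC₁_lt]
  have key : (L k).rank = r ∧
      ‖L k - Ls‖ ≤ (1 - (1 - 2 * C₁) / 8 * η) ^ k * ‖L₀ - Ls‖ := by
    induction k with
    | zero => simp [hL0, hL₀]
    | succ k ih =>
      obtain ⟨hrk, hbd⟩ := ih fun i hi => hstep i (by omega)
      -- Contraction keeps the iterates in the initial ball, so the same constants serve at every
      -- step.
      have hball : ‖L k - Ls‖ ≤ |a| * σ := hbd.trans
        ((mul_le_of_le_one_left (norm_nonneg _) (pow_le_one₀ hq₀ hq₁)).trans hinit')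
      obtain ⟨G, hG, hup⟩ := hstep k (by omega)
      obtain ⟨h1, h2⟩ := RobustPCA.IsUpdate.norm_sub_le hF hrank hrk (hnear _ hball) hC₀ hC₁_lt hη₀
        hη.le (hgrad _ G hrk hball hG) hR hup
      refine ⟨h1, h2.trans ?_⟩
      rw [pow_succ', mul_assoc]
      exact mul_le_mul_of_nonneg_left hbd hq₀
  obtain ⟨hrk, hbd⟩ := key
  have hball : ‖L k - Ls‖ ≤ |a| * σ := hbd.trans
    ((mul_le_of_le_one_left (norm_nonneg _) (pow_le_one₀ hq₀ hq₁)).trans hinit')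
  exact ⟨hbd, RobustPCA.exists_isHardThreshold (by linarith) hγ₁ _, fun G hG =>
    RobustPCA.exists_isUpdate hF hrank hrk (hnear _ hball) hC₀ hC₁_lt hη₀ hη.le
      (hgrad _ G hrk hball hG) hR⟩
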